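/- Let $n \ge 2$, $s > n/2+1$ and $T>0$. Let $H^s(\mathbb R^n)$ be the Sobolev space of real-valued functions, let $u_0 \in H^s(\mathbb R^n;\mathbb R^n)$, and let $u \in C^0([0,T];H^s(\mathbb R^n;\mathbb R^n))$. We say that $u$, with pressure $p$, is a solution on $[0,T]$ of the Euler equation $\partial_t u+(u\cdot\nabla)u=-\nabla p$, $\operatorname{div}u=0$, $u(0)=u_0$, if $\nabla p\in C^0([0,T];H^s(\mathbb R^n;\mathbb R^n))$ and, for all $t\in[0,T]$, $$u(t)=u_0+\int_0^t \big(-(u(\tau)\cdot\nabla)u(\tau)-\nabla p(\tau)\big)\,d\tau ,\qquad \operatorname{div}u(t)=0 .$$ Here $p(t)$ is for each $t\in[0,T]$ a locally integrable function on $\mathbb R^n$, and $\nabla p(t)$ is its weak gradient. Let $\chi$ be the characteristic function of the closed unit ball of $\mathbb R^n$ and let $m(D)f=\mathcal F^{-1}[m\,\mathcal F f]$ for a bounded symbol $m$, where $\mathcal F[f](\xi)=(2\pi)^{-n/2}\int e^{-ix\cdot\xi}f(x)\,dx$. For $v,w\in H^s(\mathbb R^n;\mathbb R^n)$ put $$B(v,w)=\Delta^{-1}(1-\chi(D))\sum_{j,k=1}^n\partial_jv_k\,\partial_kw_j+\sum_{j,k=1}^n\Delta^{-1}\chi(D)\,\partial_j\partial_k(v_jw_k),$$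 where $\Delta^{-1}(1-\chi(D))$ and $\Delta^{-1}\chi(D)\partial_j\partial_k$ are the Fourier multipliers with the bounded symbols $-|\xi|^{-2}(1-\chi(\xi))$ and $|\xi|^{-2}\xi_j\xi_k\chi(\xi)$. We say that $u$ is a solution on $[0,T]$ of the modified equation $\partial_tu+(u\cdot\nabla)u=\nabla B(u,u)$, $u(0)=u_0$, if for all $t\in[0,T]$ $$u(t)=u_0+\int_0^t\big(\nabla B(u(\tau),u(\tau))-(u(\tau)\cdot\nabla)u(\tau)\big)\,d\tau .$$ (i) If $u$ is a solution of the Euler equation on $[0,T]$ with some pressure $p$, then $u$ is a solution of the modified equation on $[0,T]$ (with the same $u_0$). (ii) Conversely, if $\operatorname{div}u_0=0$ and $u$ is a solution of the modified equation on $[0,T]$, then $u$ is a solution of the Euler equation on $[0,T]$ with pressure $p=-B(u,u)$; in particular $\operatorname{div}u(t)=0$ for all $t\in[0,T]$. -/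

import Mathlib

open MeasureTheory Set
open scoped SchwartzMap FourierTransform LineDeriv ContDiff

noncomputable section

namespace EulerSobolev

/-- Euclidean space `ℝⁿ`. -/
abbrev Rn (n : ℕ) : Type := EuclideanSpace ℝ (Fin n)

/-- The `k`-th standard basis vector of `ℝⁿ`. -/
def stdVec {n : ℕ} (k : Fin n) : Rn n := EuclideanSpace.single k 1

/-- Real-valued `L²` functions on `ℝⁿ`. -/
abbrev L2R (n : ℕ) : Type := Lp ℝ 2 (volume : Measure (Rn n))

/-- Complex-valued `L²` functions on `ℝⁿ`. -/
abbrev L2C (n : ℕ) : Type := Lp ℂ 2 (volume : Measure (Rn n))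

/-- The inclusion of real-valued into complex-valued `L²` functions. -/
def toComplex (n : ℕ) : L2R n →L[ℝ] L2C n :=
  ContinuousLinearMap.compLpL 2 volume Complex.ofRealCLM

/-- The real part of a complex-valued `L²` function. -/
def realPart (n : ℕ) : L2C n →L[ℝ] L2R n :=
  ContinuousLinearMap.compLpL 2 volume Complex.reCLM

/-- The tempered distribution given by a real-valued `L²` function. -/
def toDistr {n : ℕ} (f : L2R n) : 𝓢'(Rn n, ℂ) := Lp.toTemperedDistribution (toComplex n f)

theorem toDistr_eq {n : ℕ} (f : L2R n) :
    toDistr f = Lp.toTemperedDistributionCLM ℂ volume 2 (toComplex n f) := rfl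

theorem toDistr_add {n : ℕ} (f g : L2R n) : toDistr (f + g) = toDistr f + toDistr g := by
  simp only [toDistr_eq, map_add]

theorem toDistr_smul {n : ℕ} (c : ℝ) (f : L2R n) : toDistr (c • f) = (c : ℂ) • toDistr f := by
  have h : toComplex n (c • f) = (c : ℂ) • toComplex n f := by
    rw [map_smul]
    rfl
  rw [toDistr_eq, toDistr_eq, h]
  exact (Lp.toTemperedDistributionCLM ℂ volume 2).map_smul (c : ℂ) (toComplex n f)

theorem distr_injective (n : ℕ) : Function.Injective
    (fun f : L2C n => (Lp.toTemperedDistribution f : 𝓢'(Rn n, ℂ))) := by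
  have h := LinearMap.ker_eq_bot.mp
    (Lp.ker_toTemperedDistributionCLM_eq_bot (F := ℂ) (μ := (volume : Measure (Rn n))) (p := 2))
  exact h

theorem toComplex_injective (n : ℕ) : Function.Injective (toComplex n) := by
  rw [injective_iff_map_eq_zero]
  intro f hf
  have h1 := ContinuousLinearMap.coeFn_compLp Complex.ofRealCLM f
  have h2 : Complex.ofRealCLM.compLp f = (0 : L2C n) := hf
  rw [h2] at h1
  rw [Lp.eq_zero_iff_ae_eq_zero]
  filter_upwards [h1, Lp.coeFn_zero ℂ 2 (volume : Measure (Rn n))] with x hx hx'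
  rw [hx'] at hx
  simpa using hx.symm

/-- The real-valued `L²` functions of Sobolev class `s`. -/
def sobolevSubmodule (n : ℕ) (s : ℝ) : Submodule ℝ (L2R n) where
  carrier := {f | TemperedDistribution.MemSobolev s 2 (toDistr f)}
  add_mem' {f g} hf hg := by
    simp only [mem_ofPred_eq, toDistr_add] at *
    exact hf.add hg
  zero_mem' := by
    simp only [mem_ofPred_eq, toDistr_eq, map_zero]
    exact TemperedDistribution.memSobolev_fun_zero _ _ _ _
  smul_mem' c f hf := by
    simp only [mem_ofPred_eq, toDistr_smul] at *
    exact hf.smul _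

/-- The Sobolev space `H^s(ℝⁿ)` of real-valued functions (for `s ≥ 0`). It carries the `H^s` norm
defined below, not the `L²` norm. -/
def Sob (n : ℕ) (s : ℝ) : Type := sobolevSubmodule n s

instance (n : ℕ) (s : ℝ) : AddCommGroup (Sob n s) :=
  inferInstanceAs (AddCommGroup (sobolevSubmodule n s))

instance (n : ℕ) (s : ℝ) : Module ℝ (Sob n s) :=
  inferInstanceAs (Module ℝ (sobolevSubmodule n s))

/-- The inclusion `H^s(ℝⁿ) → L²(ℝⁿ)`. -/
def Sob.toL2 {n : ℕ} {s : ℝ} : Sob n s →ₗ[ℝ] L2R n := (sobolevSubmodule n s).subtype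

/-- The linear map `H^s(ℝⁿ) → L²(ℝⁿ; ℂ)` which applies the Bessel potential, i.e. multiplies the
Fourier transform by `(1 + |ξ|²)^(s/2)`. -/
def Sob.bessel {n : ℕ} {s : ℝ} : Sob n s →ₗ[ℝ] L2C n where
  toFun f := Classical.choose f.2
  map_add' f g := by
    apply distr_injective n
    have h : toDistr (f + g).1 = toDistr f.1 + toDistr g.1 := toDistr_add f.1 g.1
    have h1 := congrArg (TemperedDistribution.besselPotential (Rn n) ℂ s) h
    rw [map_add] at h1
    refine (Classical.choose_spec (f + g).2).symm.trans (h1.trans ?_)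
    refine (congrArg₂ (· + ·) (Classical.choose_spec f.2) (Classical.choose_spec g.2)).trans ?_
    exact ((Lp.toTemperedDistributionCLM ℂ volume 2).map_add _ _).symm
  map_smul' c f := by
    apply distr_injective n
    have h : toDistr (c • f).1 = (c : ℂ) • toDistr f.1 := toDistr_smul c f.1
    have h1 := congrArg (TemperedDistribution.besselPotential (Rn n) ℂ s) h
    rw [map_smul] at h1
    refine (Classical.choose_spec (c • f).2).symm.trans (h1.trans ?_)
    refine (congrArg ((c : ℂ) • ·) (Classical.choose_spec f.2)).trans ?_
    exact ((Lp.toTemperedDistributionCLM ℂ volume 2).map_smul (c : ℂ) _).symm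

theorem Sob.bessel_spec {n : ℕ} {s : ℝ} (f : Sob n s) :
    TemperedDistribution.besselPotential (Rn n) ℂ s (toDistr f.toL2)
      = Lp.toTemperedDistribution f.bessel :=
  Classical.choose_spec f.2

theorem Sob.bessel_injective {n : ℕ} {s : ℝ} :
    Function.Injective (Sob.bessel : Sob n s →ₗ[ℝ] L2C n) := by
  intro f g hfg
  have h := f.bessel_spec
  rw [hfg, ← g.bessel_spec] at h
  have h2 := congrArg (TemperedDistribution.besselPotential (Rn n) ℂ (-s)) h
  simp only [TemperedDistribution.besselPotential_besselPotential_apply, add_neg_cancel,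
    TemperedDistribution.besselPotential_zero, ContinuousLinearMap.id_apply] at h2
  exact Subtype.ext (toComplex_injective n (distr_injective n h2))

/-- The `H^s` norm: the `L²` norm of the Bessel potential of order `s`. -/
instance (n : ℕ) (s : ℝ) : NormedAddCommGroup (Sob n s) :=
  NormedAddCommGroup.induced (Sob n s) (L2C n) Sob.bessel Sob.bessel_injective

instance (n : ℕ) (s : ℝ) : NormedSpace ℝ (Sob n s) :=
  NormedSpace.induced ℝ (Sob n s) (L2C n) Sob.bessel

/-- The `L²` class of a square-integrable function (`0` for other functions). -/
def mkL2 {n : ℕ} {K : Type*} [NormedAddCommGroup K] (f : Rn n → K) :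
    Lp K 2 (volume : Measure (Rn n)) :=
  open Classical in if h : MemLp f 2 volume then h.toLp f else 0

/-- The pointwise product of two `L²` functions, if it is again in `L²`. -/
def mulL2 {n : ℕ} (f g : L2R n) : L2R n := mkL2 fun x => f x * g x

/-- The partial derivative `∂ₖ f` in the sense of distributions, if it is again in `L²`. -/
def pderiv {n : ℕ} (k : Fin n) (f : L2R n) : L2R n :=
  open Classical in
  if h : ∃ g : L2R n, toDistr g = ∂_{stdVec k} (toDistr f) then Classical.choose h else 0

/-- The Fourier multiplier `m(D) f = F⁻¹[m(ξ) F[f](ξ)]` for a bounded even real symbol `m` (for such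
a symbol the result is real-valued, so that taking the real part only changes the type). Here `ξ` is
the angular frequency, `F[f](ξ) = (2π)^(-n/2) ∫ e^(-i x·ξ) f(x) dx`; the transform `𝓕` has kernel
`e^(-2πi x·ξ)`, which accounts for the factor `2π`. -/
def multiplier {n : ℕ} (m : Rn n → ℝ) (f : L2R n) : L2R n :=
  realPart n (𝓕⁻ (mkL2 (fun ξ => (m ((2 * Real.pi) • ξ) : ℂ) * (𝓕 (toComplex n f) : L2C n) ξ) :
    L2C n) : L2C n)

/-- The characteristic function of the closed unit ball. -/
def cutoff {n : ℕ} : Rn n → ℝ := (Metric.closedBall (0 : Rn n) 1).indicator 1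

/-- The operator `Δ⁻¹ (1 - χ(D))`, where `Δ` has the symbol `-|ξ|²`. -/
def invLaplaceHigh {n : ℕ} : L2R n → L2R n :=
  multiplier fun ξ => (-‖ξ‖ ^ 2)⁻¹ * (1 - cutoff ξ)

/-- The operator `Δ⁻¹ χ(D) ∂ⱼ ∂ₖ`, where `∂ⱼ ∂ₖ` has the symbol `(i ξⱼ)(i ξₖ) = -ξⱼ ξₖ`. -/
def invLaplaceLow {n : ℕ} (j k : Fin n) : L2R n → L2R n :=
  multiplier fun ξ => (-‖ξ‖ ^ 2)⁻¹ * cutoff ξ * (-(ξ j * ξ k))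

/-- Vector fields on `ℝⁿ` with components in `L²`. -/
abbrev VL2 (n : ℕ) : Type := Fin n → L2R n

/-- The Sobolev space `H^s(ℝⁿ; ℝⁿ)` of vector fields. -/
abbrev VSob (n : ℕ) (s : ℝ) : Type := Fin n → Sob n s

/-- A Sobolev vector field as an `L²` vector field. -/
def VSob.toL2 {n : ℕ} {s : ℝ} (v : VSob n s) : VL2 n := fun i => (v i).toL2

/-- `B₁(v, w) = Δ⁻¹ (1 - χ(D)) ∑ⱼₖ ∂ⱼ vₖ ∂ₖ wⱼ`. -/
def B₁ {n : ℕ} (v w : VL2 n) : L2R n :=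
  invLaplaceHigh (∑ j, ∑ k, mulL2 (pderiv j (v k)) (pderiv k (w j)))

/-- `B₂(v, w) = Δ⁻¹ χ(D) ∑ⱼₖ ∂ⱼ ∂ₖ (vⱼ wₖ)`. -/
def B₂ {n : ℕ} (v w : VL2 n) : L2R n :=
  ∑ j, ∑ k, invLaplaceLow j k (mulL2 (v j) (w k))

/-- `B(v, w) = B₁(v, w) + B₂(v, w)`. -/
def B {n : ℕ} (v w : VL2 n) : L2R n := B₁ v w + B₂ v w

/-- The divergence `∑ₖ ∂ₖ vₖ`. -/
def divergence {n : ℕ} (v : VL2 n) : L2R n := ∑ k, pderiv k (v k)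

/-- The gradient. -/
def grad {n : ℕ} (f : L2R n) : VL2 n := fun k => pderiv k f

/-- `(v · ∇) w = ∑ₖ vₖ ∂ₖ w`, componentwise. -/
def advect {n : ℕ} (v w : VL2 n) : VL2 n := fun i => ∑ k, mulL2 (v k) (pderiv k (w i))

/-- `q` is locally integrable and has the vector field `G` as its weak gradient. -/
def HasWeakGrad {n : ℕ} (q : Rn n → ℝ) (G : VL2 n) : Prop :=
  LocallyIntegrable q volume ∧
    ∀ φ : Rn n → ℝ, ContDiff ℝ ∞ φ → HasCompactSupport φ → ∀ k : Fin n,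
      ∫ x, q x * fderiv ℝ φ x (stdVec k) = - ∫ x, G k x * φ x

/-- `u ∈ C⁰([0,T]; H^s(ℝⁿ; ℝⁿ))` is on `[0,T]` a solution, with pressure `p` and initial value `u₀`,
of the incompressible Euler equation: `∇p ∈ C⁰([0,T]; H^s(ℝⁿ; ℝⁿ))`,
`u(t) = u₀ + ∫₀ᵗ -(u(τ)·∇)u(τ) - ∇p(τ) dτ` and `div u(t) = 0` for all `t ∈ [0,T]`. The field `G` is
`∇p`. -/
def IsEulerSolution {n : ℕ} {s : ℝ} (T : ℝ) (u₀ : VSob n s) (u : ℝ → VSob n s)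
    (p : ℝ → Rn n → ℝ) : Prop :=
  ContinuousOn u (Icc 0 T) ∧
  ∃ G : ℝ → VSob n s, ContinuousOn G (Icc 0 T) ∧
    (∀ t ∈ Icc 0 T, HasWeakGrad (p t) (G t).toL2) ∧
    (∀ t ∈ Icc 0 T, (u t).toL2 = u₀.toL2 +
      ∫ τ in (0 : ℝ)..t, (-advect (u τ).toL2 (u τ).toL2 - (G τ).toL2)) ∧
    ∀ t ∈ Icc 0 T, divergence (u t).toL2 = 0

/-- `u ∈ C⁰([0,T]; H^s(ℝⁿ; ℝⁿ))` is on `[0,T]` a solution with initial value `u₀` of the modified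
equation: `u(t) = u₀ + ∫₀ᵗ ∇B(u(τ),u(τ)) - (u(τ)·∇)u(τ) dτ` for all `t ∈ [0,T]`. -/
def IsModifiedSolution {n : ℕ} {s : ℝ} (T : ℝ) (u₀ : VSob n s) (u : ℝ → VSob n s) : Prop :=
  ContinuousOn u (Icc 0 T) ∧
  ∀ t ∈ Icc 0 T, (u t).toL2 = u₀.toL2 +
    ∫ τ in (0 : ℝ)..t,
      (grad (B (u τ).toL2 (u τ).toL2) - advect (u τ).toL2 (u τ).toL2)

end EulerSobolev

end

/-!
Everything is done on the Fourier side. A real-valued `f ∈ L²` is represented by its transform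
`fhat f`, membership in `H^r` is square integrability of `(1 + |ξ|²)^(r/2) fhat f`
(`mem_sobolev_iff`), and a function with the Hermitian symmetry `h(-ξ) = conj (h ξ)` is the
transform of a real-valued one (`fhat_ofFourier`). Hence `∂ₖ`, `Δ⁻¹(1 - χ(D))` and
`Δ⁻¹χ(D)∂ⱼ∂ₖ` are bounded operators between Sobolev spaces (`exists_multiplier`). For `r > n/2`
transforms of elements of `H^r` are integrable, products become convolutions (`fhat_mulL2`), and
Young's inequality makes `H^r` an algebra (`exists_mulS`); the product rule follows by density
(`pderiv_mulL2`). With `r = s - 1` every term of both equations is thereby a continuous function of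
`u ∈ H^s`, with values in `H^(s-1)`, and `∇B(u, u)` is even continuous with values in `H^s`.

Write `d = div u` and `M = ∑ⱼₖ ∂ⱼuₖ ∂ₖuⱼ`. The product rule gives `div ((u·∇)u) = M + u·∇d`
(`divergence_advect`), and `B` is designed so that
`Δ B(u, u) = M + χ(D)(u·∇d + div (u d))` (`fhat_divergence_grad_B`).

For an Euler solution `d = 0`, and taking the divergence of the equation yields
`div ∇p = -M = -div ∇B(u, u)`. The field `∇p + ∇B(u, u)` is square integrable and free of curl and of
divergence, so it vanishes (`eq_zero_of_curl_div`, `pressure_gradient_eq`). That `∇p` is free of curl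
uses only test functions, so no growth condition on `p` is needed.

For a solution of the modified equation, `d` satisfies
`d' = -u·∇d + χ(D)(u·∇d + div (u d))` in `L²`. Since `2⟨u·∇d, d⟩ = -⟨d, d²⟩`,
`u·∇d + div (u d) = 2 div (u d) - d²`, and `χ(D)∂ₖ` is bounded on `L²`, the right-hand side paired
with `d` is at most a constant times `‖u‖ ‖d‖²` (`exists_energy_bound`). Grönwall's inequality gives
`d = 0`, and the equation is then the Euler equation with pressure `-B(u, u)`.
-/

noncomputable section

namespace EulerSobolev

open TemperedDistribution Filter
open scoped ENNReal ComplexConjugate Convolution Topology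

/-! ### The Fourier transform on `L²` -/

/-- On `L¹ ∩ L²` the Fourier transform of `L²` is given by the Fourier integral. -/
theorem fourier_toLp_ae_eq {n : ℕ} {F : Rn n → ℂ} (h1 : Integrable F) (h2 : MemLp F 2 volume) :
    (𝓕 (h2.toLp F : L2C n) : L2C n) =ᵐ[volume] 𝓕 F := by
  have hc : Continuous (𝓕 F) :=
    VectorFourier.fourierIntegral_continuous Real.continuous_fourierChar continuous_inner h1
  refine ae_eq_of_integral_contDiff_smul_eq ((Lp.memLp _).locallyIntegrable one_le_two)
    hc.locallyIntegrable fun g hg hgc => ?_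
  have hg₁ : HasCompactSupport (Complex.ofRealCLM ∘ g) := hgc.comp_left rfl
  have hg₂ : ContDiff ℝ ∞ (Complex.ofRealCLM ∘ g) := by fun_prop
  set φ : 𝓢(Rn n, ℂ) := hg₁.toSchwartzMap hg₂
  calc
    _ = (Lp.toTemperedDistribution (𝓕 (h2.toLp F : L2C n)) : 𝓢'(Rn n, ℂ)) φ := by simp [φ]
    _ = ∫ ξ, 𝓕 φ ξ • F ξ := by
        rw [← Lp.fourier_toTemperedDistribution_eq, TemperedDistribution.fourier_apply,
          Lp.toTemperedDistribution_apply]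
        apply integral_congr_ae
        filter_upwards [h2.coeFn_toLp] with x hx
        rw [hx]
    _ = ∫ ξ, φ ξ • 𝓕 F ξ := by
        simpa using! VectorFourier.integral_fourierIntegral_smul_eq_flip (L := innerₗ (Rn n))
          (μ := volume) (ν := volume)
          Real.continuous_fourierChar continuous_inner φ.integrable h1
    _ = _ := by simp [φ]

/-- On `L¹ ∩ L²` the inverse Fourier transform of `L²` is given by the inverse Fourier integral. -/
theorem fourierInv_toLp_ae_eq {n : ℕ} {F : Rn n → ℂ} (h1 : Integrable F)
    (h2 : MemLp F 2 volume) :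
    (𝓕⁻ (h2.toLp F : L2C n) : L2C n) =ᵐ[volume] 𝓕⁻ F := by
  have hc : Continuous (𝓕⁻ F) :=
    VectorFourier.fourierIntegral_continuous Real.continuous_fourierChar
      (continuous_inner.neg) h1
  refine ae_eq_of_integral_contDiff_smul_eq ((Lp.memLp _).locallyIntegrable one_le_two)
    hc.locallyIntegrable fun g hg hgc => ?_
  have hg₁ : HasCompactSupport (Complex.ofRealCLM ∘ g) := hgc.comp_left rfl
  have hg₂ : ContDiff ℝ ∞ (Complex.ofRealCLM ∘ g) := by fun_prop
  set φ : 𝓢(Rn n, ℂ) := hg₁.toSchwartzMap hg₂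
  calc
    _ = (Lp.toTemperedDistribution (𝓕⁻ (h2.toLp F : L2C n)) : 𝓢'(Rn n, ℂ)) φ := by simp [φ]
    _ = ∫ ξ, 𝓕⁻ φ ξ • F ξ := by
        rw [← Lp.fourierInv_toTemperedDistribution_eq, TemperedDistribution.fourierInv_apply,
          Lp.toTemperedDistribution_apply]
        apply integral_congr_ae
        filter_upwards [h2.coeFn_toLp] with x hx
        rw [hx]
    _ = ∫ ξ, φ ξ • 𝓕⁻ F ξ := by
        have := VectorFourier.integral_fourierIntegral_smul_eq_flip (L := -innerₗ (Rn n))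
          (μ := volume) (ν := volume)
          Real.continuous_fourierChar (continuous_inner.neg) φ.integrable h1
        have h3 : (-innerₗ (Rn n)).flip = -innerₗ (Rn n) := by
          ext x y; simp [real_inner_comm]
        rw [h3] at this
        rw [SchwartzMap.fourierInv_coe]
        exact this
    _ = _ := by simp [φ]

/-- Complex conjugation on `L²`. -/
def conjL (n : ℕ) : L2C n →L[ℝ] L2C n :=
  ContinuousLinearMap.compLpL 2 volume (Complex.conjCLE : ℂ →L[ℝ] ℂ)

theorem conjL_ae {n : ℕ} (g : L2C n) : conjL n g =ᵐ[volume] fun x => conj (g x) :=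
  ContinuousLinearMap.coeFn_compLp (Complex.conjCLE : ℂ →L[ℝ] ℂ) g

theorem toComplex_ae {n : ℕ} (f : L2R n) : toComplex n f =ᵐ[volume] fun x => (f x : ℂ) :=
  ContinuousLinearMap.coeFn_compLp Complex.ofRealCLM f

theorem realPart_ae {n : ℕ} (f : L2C n) : realPart n f =ᵐ[volume] fun x => (f x).re :=
  ContinuousLinearMap.coeFn_compLp Complex.reCLM f

theorem quasiMeasurePreserving_neg (n : ℕ) :
    Measure.QuasiMeasurePreserving (fun x : Rn n => -x) volume volume :=
  (Measure.measurePreserving_neg (volume : Measure (Rn n))).quasiMeasurePreserving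

/-- The reflection `g ↦ g(-·)` on `L²`. -/
def reflL (n : ℕ) : L2C n →+ L2C n :=
  Lp.compMeasurePreserving (fun x : Rn n => -x) (Measure.measurePreserving_neg volume)

theorem reflL_ae {n : ℕ} (g : L2C n) : reflL n g =ᵐ[volume] fun x => g (-x) :=
  Lp.coeFn_compMeasurePreserving g _

theorem continuous_reflL (n : ℕ) : Continuous (reflL n) :=
  (Lp.isometry_compMeasurePreserving _).continuous

theorem fourier_conj_apply {n : ℕ} (F : Rn n → ℂ) (ξ : Rn n) :
    𝓕 (fun x => conj (F x)) ξ = conj (𝓕 F (-ξ)) := by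
  rw [Real.fourier_eq', Real.fourier_eq', ← integral_conj]
  congr 1
  ext x
  simp [← Complex.exp_conj, Complex.conj_ofNat]

/-- Conjugating a function conjugates and reflects its Fourier transform. -/
theorem fourier_conjL {n : ℕ} (g : L2C n) : 𝓕 (conjL n g) = conjL n (reflL n (𝓕 g)) := by
  refine DenseRange.induction_on
    (p := fun g : L2C n => 𝓕 (conjL n g) = conjL n (reflL n (𝓕 g)))
    (SchwartzMap.denseRange_toLpCLM (p := 2) (μ := (volume : Measure (Rn n)))
      ENNReal.ofNat_ne_top) g ?_ fun φ => ?_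
  · apply isClosed_eq
    · exact (Lp.fourierTransformₗᵢ (Rn n) ℂ).continuous.comp (conjL n).continuous
    · exact (conjL n).continuous.comp ((continuous_reflL n).comp
        (Lp.fourierTransformₗᵢ (Rn n) ℂ).continuous)
  · have h1 : Integrable (φ : Rn n → ℂ) := φ.integrable
    have h2 : MemLp (φ : Rn n → ℂ) 2 volume := φ.memLp 2 volume
    have e1 : SchwartzMap.toLpCLM ℝ ℂ 2 volume φ = (h2.toLp _ : L2C n) := rfl
    have h1c : Integrable (fun x => conj (φ x)) := by
      simpa using (Complex.conjCLE : ℂ →L[ℝ] ℂ).integrable_comp h1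
    have h2c : MemLp (fun x => conj (φ x)) 2 volume :=
      (Complex.conjCLE : ℂ →L[ℝ] ℂ).comp_memLp' h2
    have e2 : conjL n (h2.toLp _) = h2c.toLp _ := by
      apply Lp.ext
      filter_upwards [conjL_ae (h2.toLp _), h2.coeFn_toLp, h2c.coeFn_toLp] with x a b c
      rw [a, b, c]
    rw [e1, e2]
    apply Lp.ext
    filter_upwards [fourier_toLp_ae_eq h1c h2c, conjL_ae (reflL n (𝓕 (h2.toLp _ : L2C n))),
      reflL_ae (𝓕 (h2.toLp _ : L2C n)),
      (quasiMeasurePreserving_neg n).ae (fourier_toLp_ae_eq h1 h2)] with x a b c d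
    rw [a, b, c, d, fourier_conj_apply]

/-- The Fourier transform of a real-valued square-integrable function. -/
def fhat {n : ℕ} : L2R n →L[ℝ] L2C n :=
  ((Lp.fourierTransformₗᵢ (Rn n) ℂ).toContinuousLinearEquiv.toContinuousLinearMap.restrictScalars
    ℝ).comp (toComplex n)

theorem fhat_apply {n : ℕ} (f : L2R n) : fhat f = 𝓕 (toComplex n f) := rfl

theorem norm_toComplex {n : ℕ} (f : L2R n) : ‖toComplex n f‖ = ‖f‖ := by
  rw [Lp.norm_def, Lp.norm_def]
  congr 1
  apply eLpNorm_congr_norm_ae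
  filter_upwards [toComplex_ae f] with x hx
  simp [hx]

/-- Plancherel's identity for real-valued functions. -/
theorem norm_fhat {n : ℕ} (f : L2R n) : ‖fhat f‖ = ‖f‖ := by
  rw [fhat_apply, Lp.norm_fourier_eq, norm_toComplex]

theorem fhat_injective (n : ℕ) : Function.Injective (fhat : L2R n → L2C n) := by
  intro f g h
  exact toComplex_injective n ((Lp.fourierTransformₗᵢ (Rn n) ℂ).injective h)

/-- `h` has the symmetry of the Fourier transform of a real-valued function. -/
def Hermitian {n : ℕ} (h : Rn n → ℂ) : Prop := ∀ᵐ ξ, h (-ξ) = conj (h ξ)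

theorem hermitian_fhat {n : ℕ} (f : L2R n) : Hermitian (fhat f) := by
  have h1 : conjL n (toComplex n f) = toComplex n f := by
    apply Lp.ext
    filter_upwards [conjL_ae (toComplex n f), toComplex_ae f] with x a b
    rw [a, b, Complex.conj_ofReal]
  have h2 := fourier_conjL (toComplex n f)
  rw [h1, ← fhat_apply] at h2
  have h3 : ∀ᵐ ξ, fhat f ξ = conj (fhat f (-ξ)) := by
    filter_upwards [conjL_ae (reflL n (fhat f)), reflL_ae (fhat f)] with x a b
    conv_lhs => rw [h2]
    rw [a, b]
  filter_upwards [h3] with ξ h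
  rw [h, Complex.conj_conj]

theorem toComplex_realPart_fourierInv {n : ℕ} (h : L2C n) (hh : Hermitian h) :
    toComplex n (realPart n (𝓕⁻ h)) = 𝓕⁻ h := by
  have h1 : conjL n (𝓕⁻ h) = 𝓕⁻ h := by
    apply (Lp.fourierTransformₗᵢ (Rn n) ℂ).injective
    change 𝓕 (conjL n (𝓕⁻ h)) = 𝓕 (𝓕⁻ h)
    rw [fourier_conjL, FourierTransform.fourier_fourierInv_eq]
    apply Lp.ext
    filter_upwards [conjL_ae (reflL n h), reflL_ae h, hh] with x a b c
    rw [a, b, c, Complex.conj_conj]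
  apply Lp.ext
  filter_upwards [toComplex_ae (realPart n (𝓕⁻ h)), realPart_ae (𝓕⁻ h), conjL_ae (𝓕⁻ h)]
    with x a b c
  rw [h1] at c
  rw [a, b]
  exact (Complex.conj_eq_iff_re.mp c.symm)

theorem mkL2_of_memLp {n : ℕ} {K : Type*} [NormedAddCommGroup K] {f : Rn n → K}
    (h : MemLp f 2 volume) : mkL2 f = h.toLp f := dif_pos h

theorem mkL2_ae {n : ℕ} {K : Type*} [NormedAddCommGroup K] {f : Rn n → K}
    (h : MemLp f 2 volume) : mkL2 f =ᵐ[volume] f := by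
  rw [mkL2_of_memLp h]; exact h.coeFn_toLp

theorem Hermitian.congr {n : ℕ} {g h : Rn n → ℂ} (hg : Hermitian g) (e : g =ᵐ[volume] h) :
    Hermitian h := by
  filter_upwards [hg, e, (quasiMeasurePreserving_neg n).ae e] with x a b c
  rw [← b, ← c, a]

theorem Hermitian.mul {n : ℕ} {g h : Rn n → ℂ} (hg : Hermitian g) (hh : Hermitian h) :
    Hermitian (fun ξ => g ξ * h ξ) := by
  filter_upwards [hg, hh] with x a b
  rw [a, b, map_mul]

/-- The real-valued function with a given Hermitian Fourier transform. -/
def ofFourier {n : ℕ} (h : Rn n → ℂ) : L2R n := realPart n (𝓕⁻ (mkL2 h : L2C n) : L2C n)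

theorem fhat_ofFourier {n : ℕ} {h : Rn n → ℂ} (h2 : MemLp h 2 volume) (hh : Hermitian h) :
    fhat (ofFourier h) =ᵐ[volume] h := by
  have := toComplex_realPart_fourierInv (mkL2 h : L2C n) (hh.congr (mkL2_ae h2).symm)
  rw [fhat_apply, ofFourier, this, FourierTransform.fourier_fourierInv_eq]
  exact mkL2_ae h2

/-! ### Tempered distributions and square-integrable functions -/

/-- An identity `a g = h` of tempered distributions, with square-integrable `g` and `h`, holds
almost everywhere. -/
theorem smulLeftCLM_eq_iff {n : ℕ} {a : Rn n → ℂ} (ha : a.HasTemperateGrowth) (g h : L2C n) :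
    smulLeftCLM ℂ a (g : 𝓢'(Rn n, ℂ)) = (h : 𝓢'(Rn n, ℂ)) ↔
      h =ᵐ[volume] fun ξ => a ξ * g ξ := by
  constructor
  · intro e
    have hl : LocallyIntegrable (fun ξ => a ξ * g ξ) volume := by
      have := ((Lp.memLp g).locallyIntegrable one_le_two)
      have := (locallyIntegrableOn_univ.mpr this).continuousOn_mul
        (ha.1.continuous.continuousOn) isOpen_univ.isLocallyClosed
      exact locallyIntegrableOn_univ.mp this
    refine ae_eq_of_integral_contDiff_smul_eq ((Lp.memLp _).locallyIntegrable one_le_two)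
      hl fun ψ hψ hψc => ?_
    have hg₁ : HasCompactSupport (Complex.ofRealCLM ∘ ψ) := hψc.comp_left rfl
    have hg₂ : ContDiff ℝ ∞ (Complex.ofRealCLM ∘ ψ) := by fun_prop
    have := congrArg (fun D : 𝓢'(Rn n, ℂ) => D (hg₁.toSchwartzMap hg₂)) e
    simp [ha] at this
    simp only [Complex.real_smul]
    rw [← this]
    congr 1
    ext x
    ring
  · intro e
    ext u
    simp only [Lp.toTemperedDistribution_apply, smulLeftCLM_apply_apply]
    apply integral_congr_ae
    filter_upwards [e] with x hx
    simp [hx, ha]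
    ring

/-! ### Sobolev spaces on the Fourier side -/

/-- The weight `(1 + |ξ|²)^(s/2)`. -/
def weight {n : ℕ} (s : ℝ) (ξ : Rn n) : ℝ := (1 + ‖ξ‖ ^ 2) ^ (s / 2)

theorem weight_pos {n : ℕ} (s : ℝ) (ξ : Rn n) : 0 < weight s ξ := by
  unfold weight; positivity

theorem weight_mono {n : ℕ} {s t : ℝ} (h : s ≤ t) (ξ : Rn n) : weight s ξ ≤ weight t ξ :=
  Real.rpow_le_rpow_of_exponent_le (by simp) (by linarith)

theorem weight_add {n : ℕ} (s t : ℝ) (ξ : Rn n) : weight (s + t) ξ = weight s ξ * weight t ξ := by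
  unfold weight
  rw [← Real.rpow_add (by positivity)]
  ring_nf

@[simp] theorem weight_zero {n : ℕ} (ξ : Rn n) : weight 0 ξ = 1 := by simp [weight]

theorem one_le_weight {n : ℕ} {s : ℝ} (h : 0 ≤ s) (ξ : Rn n) : 1 ≤ weight s ξ := by
  simpa using weight_mono h ξ

@[simp] theorem weight_neg_arg {n : ℕ} (s : ℝ) (ξ : Rn n) : weight s (-ξ) = weight s ξ := by
  simp [weight]

theorem weight_temperate {n : ℕ} (s : ℝ) :
    (fun ξ : Rn n => (weight s ξ : ℂ)).HasTemperateGrowth := by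
  unfold weight; fun_prop

theorem measurable_weight {n : ℕ} (s : ℝ) : Measurable (weight s : Rn n → ℝ) := by
  unfold weight; fun_prop

theorem norm_weight_mul {n : ℕ} (s : ℝ) (ξ : Rn n) (z : ℂ) :
    ‖(weight s ξ : ℂ) * z‖ = weight s ξ * ‖z‖ := by
  rw [norm_mul, Complex.norm_real, Real.norm_of_nonneg (weight_pos s ξ).le]

theorem measurable_fhat {n : ℕ} (f : L2R n) : Measurable (fhat f) :=
  (Lp.stronglyMeasurable _).measurable

theorem fourier_toDistr {n : ℕ} (f : L2R n) :
    𝓕 (toDistr f) = (Lp.toTemperedDistribution (fhat f) : 𝓢'(Rn n, ℂ)) :=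
  Lp.fourier_toTemperedDistribution_eq _

theorem mem_sobolev_iff {n : ℕ} {s : ℝ} (f : L2R n) :
    f ∈ sobolevSubmodule n s ↔ MemLp (fun ξ => (weight s ξ : ℂ) * fhat f ξ) 2 volume := by
  change MemSobolev s 2 (toDistr f) ↔ _
  rw [memSobolev_iff_exists_smulLeftCLM_fourier, fourier_toDistr]
  constructor
  · rintro ⟨g, hg⟩
    have := (smulLeftCLM_eq_iff (weight_temperate s) _ _).mp hg
    exact (memLp_congr_ae this).mp (Lp.memLp g)
  · intro h
    exact ⟨h.toLp _, (smulLeftCLM_eq_iff (weight_temperate s) _ _).mpr h.coeFn_toLp⟩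

theorem fourier_bessel {n : ℕ} {s : ℝ} (f : Sob n s) :
    (𝓕 f.bessel : L2C n) =ᵐ[volume] fun ξ => (weight s ξ : ℂ) * fhat f.toL2 ξ := by
  rw [← smulLeftCLM_eq_iff (weight_temperate s), ← Lp.fourier_toTemperedDistribution_eq,
    ← f.bessel_spec, fourier_besselPotential_eq_smulLeftCLM_fourier_apply, fourier_toDistr]
  rfl

theorem Sob.norm_eq_bessel {n : ℕ} {s : ℝ} (f : Sob n s) : ‖f‖ = ‖f.bessel‖ := rfl

theorem Sob.enorm_eq {n : ℕ} {s : ℝ} (f : Sob n s) :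
    ‖f‖ₑ = eLpNorm (fun ξ => (weight s ξ : ℂ) * fhat f.toL2 ξ) 2 volume := by
  rw [← eLpNorm_congr_ae (fourier_bessel f), ← Lp.enorm_def, ← ofReal_norm, ← ofReal_norm,
    Lp.norm_fourier_eq, Sob.norm_eq_bessel]

theorem Sob.memLp {n : ℕ} {s : ℝ} (f : Sob n s) :
    MemLp (fun ξ => (weight s ξ : ℂ) * fhat f.toL2 ξ) 2 volume :=
  (mem_sobolev_iff f.toL2).mp f.2

theorem Sob.toL2_injective {n : ℕ} {s : ℝ} :
    Function.Injective (Sob.toL2 : Sob n s →ₗ[ℝ] L2R n) := Subtype.val_injective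

/-- An element of `H^s` from its Fourier transform. -/
theorem exists_sob_of_fourier {n : ℕ} {s : ℝ} (hs : 0 ≤ s) {h : Rn n → ℂ}
    (hm : AEStronglyMeasurable h volume)
    (hh : Hermitian h) (hw : MemLp (fun ξ => (weight s ξ : ℂ) * h ξ) 2 volume) :
    ∃ f : Sob n s, fhat f.toL2 =ᵐ[volume] h := by
  have h2 : MemLp h 2 volume := by
    refine hw.mono hm (Eventually.of_forall fun ξ => ?_)
    rw [norm_weight_mul]
    exact le_mul_of_one_le_left (norm_nonneg _) (one_le_weight hs ξ)
  refine ⟨⟨ofFourier h, ?_⟩, fhat_ofFourier h2 hh⟩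
  rw [mem_sobolev_iff]
  refine (memLp_congr_ae ?_).mp hw
  filter_upwards [fhat_ofFourier h2 hh] with x hx
  rw [hx]

theorem ext_fhat {n : ℕ} {f g : L2R n} (h : fhat f =ᵐ[volume] fhat g) : f = g :=
  fhat_injective n (Lp.ext h)

theorem Sob.ext_fhat {n : ℕ} {s : ℝ} {f g : Sob n s}
    (h : fhat f.toL2 =ᵐ[volume] fhat g.toL2) : f = g :=
  Sob.toL2_injective (EulerSobolev.ext_fhat h)

theorem fhat_add_ae {n : ℕ} (f g : L2R n) :
    fhat (f + g) =ᵐ[volume] fun ξ => fhat f ξ + fhat g ξ := by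
  rw [map_add]; exact Lp.coeFn_add _ _

theorem fhat_sub_ae {n : ℕ} (f g : L2R n) :
    fhat (f - g) =ᵐ[volume] fun ξ => fhat f ξ - fhat g ξ := by
  rw [map_sub]; exact Lp.coeFn_sub _ _

theorem fhat_smul_ae {n : ℕ} (c : ℝ) (f : L2R n) :
    fhat (c • f) =ᵐ[volume] fun ξ => (c : ℂ) * fhat f ξ := by
  rw [map_smul]
  filter_upwards [Lp.coeFn_smul c (fhat f)] with ξ h
  rw [h]; simp

theorem fhat_sum_ae {n : ℕ} {ι : Type*} (t : Finset ι) (f : ι → L2R n) :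
    fhat (∑ i ∈ t, f i) =ᵐ[volume] fun ξ => ∑ i ∈ t, fhat (f i) ξ := by
  classical
  induction t using Finset.induction_on with
  | empty => simp only [Finset.sum_empty, map_zero]; exact Lp.coeFn_zero _ _ _
  | insert a t ha ih =>
    simp only [Finset.sum_insert ha]
    filter_upwards [ih, fhat_add_ae (f a) (∑ i ∈ t, f i)] with ξ h1 h2
    rw [h2, h1]

/-- A Fourier multiplier whose symbol grows at most like `|ξ|^(r-r')` maps `H^r` to `H^r'`. -/
theorem exists_multiplier {n : ℕ} {r r' C : ℝ} {m : Rn n → ℂ} (hm : Measurable m)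
    (hH : Hermitian m) (hr' : 0 ≤ r') (hb : ∀ ξ, ‖m ξ‖ ≤ C * weight (r - r') ξ) :
    ∃ L : Sob n r →L[ℝ] Sob n r', ∀ f, fhat (L f).toL2 =ᵐ[volume] fun ξ => m ξ * fhat f.toL2 ξ := by
  have hC : 0 ≤ C := by
    by_contra h
    have := (norm_nonneg _).trans (hb 0)
    nlinarith [weight_pos (r - r') (0 : Rn n)]
  have key : ∀ (f : Sob n r) (ξ : Rn n), ‖(weight r' ξ : ℂ) * (m ξ * fhat f.toL2 ξ)‖ ≤
      C * ‖(weight r ξ : ℂ) * fhat f.toL2 ξ‖ := by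
    intro f ξ
    rw [norm_weight_mul, norm_weight_mul, norm_mul]
    have e : weight r ξ = weight r' ξ * weight (r - r') ξ := by rw [← weight_add]; ring_nf
    have := weight_pos r' ξ
    rw [e]
    calc _ ≤ weight r' ξ * ((C * weight (r - r') ξ) * ‖fhat f.toL2 ξ‖) := by gcongr; exact hb ξ
      _ = _ := by ring
  have meas : ∀ f : Sob n r, Measurable fun ξ => m ξ * fhat f.toL2 ξ :=
    fun f => hm.mul (measurable_fhat _)
  have ex : ∀ f : Sob n r, ∃ g : Sob n r',
      fhat g.toL2 =ᵐ[volume] fun ξ => m ξ * fhat f.toL2 ξ := by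
    intro f
    refine exists_sob_of_fourier hr' (meas f).aestronglyMeasurable
      (hH.mul (hermitian_fhat _)) ?_
    refine f.memLp.of_le_mul (c := C) ?_ (Eventually.of_forall (key f))
    exact (Measurable.mul (Complex.measurable_ofReal.comp (measurable_weight r'))
      (meas f)).aestronglyMeasurable
  choose L hL using ex
  refine ⟨LinearMap.mkContinuous ⟨⟨L, fun f g => ?_⟩, fun c f => ?_⟩ C fun f => ?_, hL⟩
  · apply Sob.ext_fhat
    rw [map_add]
    filter_upwards [hL (f + g), hL f, hL g, fhat_add_ae f.toL2 g.toL2,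
      fhat_add_ae (L f).toL2 (L g).toL2] with ξ h1 h2 h3 h4 h5
    rw [map_add] at h1
    rw [h1, h4, h5, h2, h3]; ring
  · apply Sob.ext_fhat
    rw [map_smul]
    filter_upwards [hL (c • f), hL f, fhat_smul_ae c f.toL2,
      fhat_smul_ae c (L f).toL2] with ξ h1 h2 h4 h5
    rw [map_smul] at h1
    simp only [RingHom.id_apply]
    rw [h1, h4, h5, h2]; ring
  · have h : ‖L f‖ₑ ≤ ENNReal.ofReal C * ‖f‖ₑ := by
      rw [Sob.enorm_eq, Sob.enorm_eq]
      refine eLpNorm_le_mul_eLpNorm_of_ae_le_mul ?_ _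
      filter_upwards [hL f] with ξ hξ
      rw [hξ]
      exact key f ξ
    rw [← ofReal_norm, ← ofReal_norm, ← ENNReal.ofReal_mul hC] at h
    exact (ENNReal.ofReal_le_ofReal_iff (by positivity)).mp h

theorem hermitian_ofReal {n : ℕ} {m : Rn n → ℝ} (h : ∀ ξ, m (-ξ) = m ξ) :
    Hermitian (fun ξ => (m ξ : ℂ)) := by
  refine Eventually.of_forall fun ξ => ?_
  simp [h ξ]

theorem memLp_fhat {n : ℕ} (f : L2R n) : MemLp (fhat f) 2 volume := Lp.memLp _

theorem fhat_multiplier {n : ℕ} {m : Rn n → ℝ} (hm : Measurable m) (he : ∀ ξ, m (-ξ) = m ξ)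
    {C : ℝ} (hb : ∀ ξ, |m ξ| ≤ C) (f : L2R n) :
    fhat (multiplier m f) =ᵐ[volume]
      fun ξ => (m ((2 * Real.pi) • ξ) : ℂ) * fhat f ξ := by
  refine fhat_ofFourier ?_ ?_
  · refine (memLp_fhat f).of_le_mul (c := C) ?_ (Eventually.of_forall fun ξ => ?_)
    · refine (Measurable.mul ?_ (measurable_fhat f)).aestronglyMeasurable
      exact Complex.measurable_ofReal.comp (hm.comp (by fun_prop))
    · rw [norm_mul, Complex.norm_real]
      exact mul_le_mul_of_nonneg_right (hb _) (norm_nonneg _)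
  · exact (hermitian_ofReal fun ξ => by rw [smul_neg, he]).mul (hermitian_fhat f)

/-- The symbol `2πi ξₖ` of `∂ₖ`. -/
def dsymb {n : ℕ} (k : Fin n) (ξ : Rn n) : ℂ := 2 * Real.pi * Complex.I * (ξ k : ℂ)

theorem measurable_dsymb {n : ℕ} (k : Fin n) : Measurable (dsymb k : Rn n → ℂ) := by
  unfold dsymb
  exact (Complex.measurable_ofReal.comp (by fun_prop)).const_mul _

theorem hermitian_dsymb {n : ℕ} (k : Fin n) : Hermitian (dsymb k : Rn n → ℂ) := by
  refine Eventually.of_forall fun ξ => ?_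
  simp [dsymb, Complex.conj_ofNat]

theorem norm_dsymb_le {n : ℕ} (k : Fin n) (ξ : Rn n) : ‖dsymb k ξ‖ ≤ 2 * Real.pi * ‖ξ‖ := by
  have : |ξ k| ≤ ‖ξ‖ := by simpa using PiLp.norm_apply_le ξ k
  simp only [dsymb, norm_mul, Complex.norm_real, Complex.norm_I, Real.norm_eq_abs,
    abs_of_pos Real.pi_pos, Complex.norm_ofNat, mul_one]
  gcongr

theorem toDistr_injective (n : ℕ) : Function.Injective (toDistr : L2R n → 𝓢'(Rn n, ℂ)) :=
  fun _ _ h => toComplex_injective n (distr_injective n h)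

theorem toDistr_eq_lineDeriv_iff {n : ℕ} (k : Fin n) (f g : L2R n) :
    toDistr g = ∂_{stdVec k} (toDistr f) ↔ fhat g =ᵐ[volume] fun ξ => dsymb k ξ * fhat f ξ := by
  have ht : (fun ξ : Rn n => ((inner ℝ ξ (stdVec k) : ℝ) : ℂ)).HasTemperateGrowth := by fun_prop
  have h1 : (fun ξ : Rn n => dsymb k ξ) =
      (2 * Real.pi * Complex.I : ℂ) • (fun ξ : Rn n => ((inner ℝ ξ (stdVec k) : ℝ) : ℂ)) := by
    ext ξ
    simp [dsymb, stdVec, EuclideanSpace.inner_single_right]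
  have htd : (fun ξ : Rn n => dsymb k ξ).HasTemperateGrowth := by
    unfold dsymb
    have : (fun ξ : Rn n => ((inner ℝ ξ (stdVec k) : ℝ) : ℂ)) = fun ξ => ((ξ k : ℝ) : ℂ) := by
      ext ξ
      simp [stdVec, EuclideanSpace.inner_single_right]
    rw [this] at ht
    fun_prop
  rw [← smulLeftCLM_eq_iff htd, h1, smulLeftCLM_smul ht, ← fourier_toDistr, ← fourier_toDistr]
  constructor
  · intro h
    rw [h, fourier_lineDerivOp_eq]; rfl
  · intro h
    have h2 : 𝓕 (toDistr g) = 𝓕 (∂_{stdVec k} (toDistr f)) := by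
      rw [fourier_lineDerivOp_eq, ← h]; rfl
    have := congrArg (fun D : 𝓢'(Rn n, ℂ) => 𝓕⁻ D) h2
    simpa using this

theorem pderiv_eq_of_fhat {n : ℕ} (k : Fin n) {f g : L2R n}
    (h : fhat g =ᵐ[volume] fun ξ => dsymb k ξ * fhat f ξ) :
    pderiv k f = g := by
  have hg := (toDistr_eq_lineDeriv_iff k f g).mpr h
  have hex : ∃ g : L2R n, toDistr g = ∂_{stdVec k} (toDistr f) := ⟨g, hg⟩
  rw [pderiv, dif_pos hex]
  exact toDistr_injective n ((Classical.choose_spec hex).trans hg.symm)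

/-! ### Operators between Sobolev spaces -/

theorem eLpNorm_two_sq {α E : Type*} [MeasurableSpace α] [NormedAddCommGroup E] (μ : Measure α)
    (f : α → E) : eLpNorm f 2 μ ^ 2 = ∫⁻ x, ‖f x‖ₑ ^ 2 ∂μ := by
  have := eLpNorm_nnreal_pow_eq_lintegral (μ := μ) (f := f) (p := 2) two_ne_zero
  simpa using this

theorem hermitian_one {n : ℕ} : Hermitian (fun _ : Rn n => (1 : ℂ)) :=
  Eventually.of_forall fun ξ => by simp

/-- The inclusion `H^r → H^r'` for `0 ≤ r' ≤ r`. -/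
theorem exists_incl {n : ℕ} {r r' : ℝ} (h0 : 0 ≤ r') (h : r' ≤ r) :
    ∃ L : Sob n r →L[ℝ] Sob n r', ∀ f, (L f).toL2 = f.toL2 := by
  obtain ⟨L, hL⟩ := exists_multiplier (n := n) (r := r) (r' := r') (C := 1) (m := fun _ => 1)
    measurable_const hermitian_one h0 fun ξ => by simpa using one_le_weight (by linarith) ξ
  refine ⟨L, fun f => ext_fhat ?_⟩
  filter_upwards [hL f] with ξ h
  rw [h, one_mul]

/-- The inclusion `H^r → H^r'` for `0 ≤ r' ≤ r`. -/
def incl {n : ℕ} {r r' : ℝ} (h0 : 0 ≤ r') (h : r' ≤ r) : Sob n r →L[ℝ] Sob n r' :=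
  (exists_incl h0 h).choose

@[simp] theorem toL2_incl {n : ℕ} {r r' : ℝ} (h0 : 0 ≤ r') (h : r' ≤ r) (f : Sob n r) :
    (incl h0 h f).toL2 = f.toL2 := (exists_incl h0 h).choose_spec f

theorem norm_toL2_le {n : ℕ} {r : ℝ} (h0 : 0 ≤ r) (f : Sob n r) : ‖f.toL2‖ ≤ ‖f‖ := by
  have h : ‖fhat f.toL2‖ₑ ≤ ‖f‖ₑ := by
    rw [Sob.enorm_eq, Lp.enorm_def]
    refine eLpNorm_mono_ae (Eventually.of_forall fun ξ => ?_)
    rw [norm_weight_mul]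
    exact le_mul_of_one_le_left (norm_nonneg _) (one_le_weight h0 ξ)
  rw [← ofReal_norm, ← ofReal_norm, norm_fhat] at h
  exact (ENNReal.ofReal_le_ofReal_iff (norm_nonneg _)).mp h

/-- The inclusion `H^r → L²` for `r ≥ 0`, as a bounded operator. -/
def toL2L {n : ℕ} {r : ℝ} (h0 : 0 ≤ r) : Sob n r →L[ℝ] L2R n :=
  LinearMap.mkContinuous Sob.toL2 1 fun f => by simpa using norm_toL2_le h0 f

theorem exists_deriv {n : ℕ} (k : Fin n) {r r' : ℝ} (h0 : 0 ≤ r') (h : r' + 1 ≤ r) :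
    ∃ L : Sob n r →L[ℝ] Sob n r', ∀ f, (L f).toL2 = pderiv k f.toL2 ∧
      fhat (L f).toL2 =ᵐ[volume] fun ξ => dsymb k ξ * fhat f.toL2 ξ := by
  obtain ⟨L, hL⟩ := exists_multiplier (n := n) (r := r) (r' := r') (C := 2 * Real.pi)
    (measurable_dsymb k) (hermitian_dsymb k) h0 fun ξ => by
      refine (norm_dsymb_le k ξ).trans ?_
      gcongr
      refine le_trans ?_ (weight_mono (show 1 ≤ r - r' by linarith) ξ)
      unfold weight
      rw [← Real.sqrt_eq_rpow]
      apply Real.le_sqrt_of_sq_le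
      simp
  exact ⟨L, fun f => ⟨(pderiv_eq_of_fhat k (hL f)).symm, hL f⟩⟩

/-- The partial derivative `∂ₖ : H^r → H^r'` for `0 ≤ r' ≤ r - 1`. -/
def D {n : ℕ} (k : Fin n) {r r' : ℝ} (h0 : 0 ≤ r') (h : r' + 1 ≤ r) : Sob n r →L[ℝ] Sob n r' :=
  (exists_deriv k h0 h).choose

@[simp] theorem toL2_D {n : ℕ} (k : Fin n) {r r' : ℝ} (h0 : 0 ≤ r') (h : r' + 1 ≤ r)
    (f : Sob n r) : (D k h0 h f).toL2 = pderiv k f.toL2 :=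
  ((exists_deriv k h0 h).choose_spec f).1

theorem fhat_pderiv {n : ℕ} (k : Fin n) {r : ℝ} (h : 1 ≤ r) (f : Sob n r) :
    fhat (pderiv k f.toL2) =ᵐ[volume] fun ξ => dsymb k ξ * fhat f.toL2 ξ := by
  have := (exists_deriv k le_rfl (show 0 + 1 ≤ r by linarith)).choose_spec f
  rw [← this.1]
  exact this.2

theorem measurable_cutoff {n : ℕ} : Measurable (cutoff : Rn n → ℝ) :=
  measurable_one.indicator Metric.isClosed_closedBall.measurableSet

theorem cutoff_neg {n : ℕ} (ξ : Rn n) : cutoff (-ξ) = cutoff ξ := by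
  simp [cutoff, indicator]

theorem cutoff_eq {n : ℕ} (ξ : Rn n) : cutoff ξ = if ‖ξ‖ ≤ 1 then 1 else 0 := by
  simp [cutoff, indicator]

/-- The symbol of `Δ⁻¹ (1 - χ(D))`. -/
def highSymb {n : ℕ} (ξ : Rn n) : ℝ := (-‖ξ‖ ^ 2)⁻¹ * (1 - cutoff ξ)

/-- The symbol of `Δ⁻¹ χ(D) ∂ⱼ ∂ₖ`. -/
def lowSymb {n : ℕ} (j k : Fin n) (ξ : Rn n) : ℝ := (-‖ξ‖ ^ 2)⁻¹ * cutoff ξ * (-(ξ j * ξ k))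

theorem measurable_highSymb {n : ℕ} : Measurable (highSymb : Rn n → ℝ) := by
  unfold highSymb
  have := measurable_cutoff (n := n)
  fun_prop

theorem measurable_lowSymb {n : ℕ} (j k : Fin n) : Measurable (lowSymb j k : Rn n → ℝ) := by
  unfold lowSymb
  have := measurable_cutoff (n := n)
  fun_prop

theorem highSymb_neg {n : ℕ} (ξ : Rn n) : highSymb (-ξ) = highSymb ξ := by
  simp [highSymb, cutoff_neg]

theorem lowSymb_neg {n : ℕ} (j k : Fin n) (ξ : Rn n) : lowSymb j k (-ξ) = lowSymb j k ξ := by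
  simp [lowSymb, cutoff_neg]

theorem abs_highSymb_le {n : ℕ} (ξ : Rn n) : |highSymb ξ| ≤ 2 * (1 + ‖ξ‖ ^ 2)⁻¹ := by
  rw [highSymb, cutoff_eq]
  split_ifs with h
  · simp; positivity
  · have h1 : 1 < ‖ξ‖ ^ 2 := by nlinarith
    have h2 : |(-‖ξ‖ ^ 2)⁻¹ * (1 - 0)| = (‖ξ‖ ^ 2)⁻¹ := by
      rw [sub_zero, mul_one, abs_inv, abs_neg, abs_of_nonneg (by positivity)]
    rw [h2, inv_le_comm₀ (by positivity) (by positivity), mul_inv, inv_inv]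
    linarith

theorem abs_lowSymb_le {n : ℕ} (j k : Fin n) (ξ : Rn n) : |lowSymb j k ξ| ≤ cutoff ξ := by
  rw [lowSymb, cutoff_eq]
  have hj : |ξ j| ≤ ‖ξ‖ := by simpa using PiLp.norm_apply_le ξ j
  have hk : |ξ k| ≤ ‖ξ‖ := by simpa using PiLp.norm_apply_le ξ k
  split_ifs with h
  · have : |(-‖ξ‖ ^ 2)⁻¹ * 1 * (-(ξ j * ξ k))| = (‖ξ‖ ^ 2)⁻¹ * (|ξ j| * |ξ k|) := by
      rw [mul_one, abs_mul, abs_inv, abs_neg, abs_neg, abs_mul,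
        abs_of_nonneg (by positivity : 0 ≤ ‖ξ‖ ^ 2)]
    rw [this]
    calc _ ≤ (‖ξ‖ ^ 2)⁻¹ * (‖ξ‖ * ‖ξ‖) := by gcongr
      _ ≤ 1 := by rw [← sq]; exact inv_mul_le_one
  · simp

theorem norm_le_norm_two_pi_smul {n : ℕ} (ξ : Rn n) : ‖ξ‖ ≤ ‖(2 * Real.pi) • ξ‖ := by
  rw [norm_smul, Real.norm_of_nonneg (by positivity)]
  exact le_mul_of_one_le_left (norm_nonneg _) (by linarith [Real.pi_gt_three])

theorem fhat_invLaplaceHigh {n : ℕ} (f : L2R n) : fhat (invLaplaceHigh f) =ᵐ[volume]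
    fun ξ => (highSymb ((2 * Real.pi) • ξ) : ℂ) * fhat f ξ := by
  refine fhat_multiplier (m := highSymb) (C := 2) measurable_highSymb highSymb_neg (fun ξ => ?_) f
  refine (abs_highSymb_le ξ).trans ?_
  have : (1 + ‖ξ‖ ^ 2)⁻¹ ≤ 1 := inv_le_one_of_one_le₀ (by simp)
  linarith

theorem fhat_invLaplaceLow {n : ℕ} (j k : Fin n) (f : L2R n) :
    fhat (invLaplaceLow j k f) =ᵐ[volume]
      fun ξ => (lowSymb j k ((2 * Real.pi) • ξ) : ℂ) * fhat f ξ := by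
  refine fhat_multiplier (m := lowSymb j k) (C := 1) (measurable_lowSymb j k) (lowSymb_neg j k)
    (fun ξ => ?_) f
  refine (abs_lowSymb_le j k ξ).trans ?_
  rw [cutoff_eq]
  split_ifs <;> simp

theorem exists_high {n : ℕ} {r r' : ℝ} (h0 : 0 ≤ r') (h : r' ≤ r + 2) :
    ∃ L : Sob n r →L[ℝ] Sob n r', ∀ f, (L f).toL2 = invLaplaceHigh f.toL2 := by
  obtain ⟨L, hL⟩ := exists_multiplier (n := n) (r := r) (r' := r') (C := 2)
    (m := fun ξ => (highSymb ((2 * Real.pi) • ξ) : ℂ))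
    (Complex.measurable_ofReal.comp (measurable_highSymb.comp (by fun_prop)))
    (hermitian_ofReal fun ξ => by rw [smul_neg, highSymb_neg]) h0 fun ξ => by
      rw [Complex.norm_real]
      refine (abs_highSymb_le _).trans ?_
      gcongr
      refine le_trans ?_ (weight_mono (show -2 ≤ r - r' by linarith) ξ)
      have : weight (-2) ξ = (1 + ‖ξ‖ ^ 2)⁻¹ := by
        rw [weight, ← Real.rpow_neg_one]; norm_num
      rw [this]
      gcongr
      exact norm_le_norm_two_pi_smul ξ
  refine ⟨L, fun f => ext_fhat ?_⟩
  filter_upwards [hL f, fhat_invLaplaceHigh f.toL2] with ξ h1 h2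
  rw [h1, h2]

/-- `Δ⁻¹ (1 - χ(D))` gains two derivatives. -/
def highL {n : ℕ} {r r' : ℝ} (h0 : 0 ≤ r') (h : r' ≤ r + 2) : Sob n r →L[ℝ] Sob n r' :=
  (exists_high h0 h).choose

@[simp] theorem toL2_highL {n : ℕ} {r r' : ℝ} (h0 : 0 ≤ r') (h : r' ≤ r + 2) (f : Sob n r) :
    (highL h0 h f).toL2 = invLaplaceHigh f.toL2 := (exists_high h0 h).choose_spec f

theorem exists_low {n : ℕ} (j k : Fin n) {r r' : ℝ} (h0 : 0 ≤ r') :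
    ∃ L : Sob n r →L[ℝ] Sob n r', ∀ f, (L f).toL2 = invLaplaceLow j k f.toL2 := by
  obtain ⟨L, hL⟩ := exists_multiplier (n := n) (r := r) (r' := r') (C := 2 ^ (|r - r'| / 2))
    (m := fun ξ => (lowSymb j k ((2 * Real.pi) • ξ) : ℂ))
    (Complex.measurable_ofReal.comp ((measurable_lowSymb j k).comp (by fun_prop)))
    (hermitian_ofReal fun ξ => by rw [smul_neg, lowSymb_neg]) h0 fun ξ => by
      rw [Complex.norm_real]
      refine (abs_lowSymb_le j k _).trans ?_
      rw [cutoff_eq]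
      split_ifs with h
      · -- on the support of the cutoff the weights lie between `1` and a power of `2`
        have h1 : ‖ξ‖ ≤ 1 := (norm_le_norm_two_pi_smul ξ).trans h
        have h2 : weight (-|r - r'|) ξ ≤ weight (r - r') ξ := weight_mono (neg_abs_le _) ξ
        have h3 : (1 + ‖ξ‖ ^ 2) ^ (|r - r'| / 2) ≤ 2 ^ (|r - r'| / 2) := by
          apply Real.rpow_le_rpow (by positivity) _ (by positivity)
          nlinarith [norm_nonneg ξ]
        have h4 : weight |r - r'| ξ * weight (-|r - r'|) ξ = 1 := by
          rw [← weight_add]; simp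
        calc (1 : ℝ) = weight |r - r'| ξ * weight (-|r - r'|) ξ := h4.symm
          _ ≤ 2 ^ (|r - r'| / 2) * weight (r - r') ξ := by
            have := (weight_pos (-|r - r'|) ξ).le
            gcongr
            exact h3
      · have := (weight_pos (r - r') ξ).le
        positivity
  refine ⟨L, fun f => ext_fhat ?_⟩
  filter_upwards [hL f, fhat_invLaplaceLow j k f.toL2] with ξ h1 h2
  rw [h1, h2]

/-- `Δ⁻¹ χ(D) ∂ⱼ ∂ₖ` is smoothing. -/
def lowL {n : ℕ} (j k : Fin n) {r r' : ℝ} (h0 : 0 ≤ r') : Sob n r →L[ℝ] Sob n r' :=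
  (exists_low j k h0).choose

@[simp] theorem toL2_lowL {n : ℕ} (j k : Fin n) {r r' : ℝ} (h0 : 0 ≤ r') (f : Sob n r) :
    (lowL j k h0 f : Sob n r').toL2 = invLaplaceLow j k f.toL2 := (exists_low j k h0).choose_spec f

/-! ### Completeness and density -/

/-- The range of the Bessel potential consists of the real-valued functions, which are the fixed
points of complex conjugation, so that `H^r` is complete. -/
theorem completeSpace_sob {n : ℕ} {r : ℝ} (h0 : 0 ≤ r) : CompleteSpace (Sob n r) := by
  have hi : Isometry (Sob.bessel : Sob n r →ₗ[ℝ] L2C n) :=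
    AddMonoidHomClass.isometry_of_norm _ fun f => rfl
  refine hi.isUniformInducing.completeSpace (IsClosed.isComplete ?_)
  have : range (Sob.bessel : Sob n r →ₗ[ℝ] L2C n) = {g | conjL n g = g} := by
    ext g
    constructor
    · rintro ⟨f, rfl⟩
      apply (Lp.fourierTransformₗᵢ (Rn n) ℂ).injective
      change 𝓕 (conjL n f.bessel) = 𝓕 f.bessel
      rw [fourier_conjL]
      have hH : Hermitian (𝓕 f.bessel : L2C n) :=
        ((hermitian_ofReal fun ξ => weight_neg_arg r ξ).mul (hermitian_fhat f.toL2)).congr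
          (fourier_bessel f).symm
      apply Lp.ext
      filter_upwards [conjL_ae (reflL n (𝓕 f.bessel)), reflL_ae (𝓕 f.bessel : L2C n), hH]
        with ξ a b c
      rw [a, b, c, Complex.conj_conj]
    · intro hg
      have hg' : conjL n g = g := hg
      have hH : Hermitian (𝓕 g : L2C n) := by
        have h1 : 𝓕 g = conjL n (reflL n (𝓕 g)) := by rw [← fourier_conjL, hg']
        filter_upwards [conjL_ae (reflL n (𝓕 g)), reflL_ae (𝓕 g : L2C n)] with ξ a b
        conv_rhs => rw [h1]
        rw [a, b, Complex.conj_conj]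
      have e : ∀ ξ : Rn n, (weight r ξ : ℂ) * ((weight (-r) ξ : ℂ) * (𝓕 g : L2C n) ξ) =
          (𝓕 g : L2C n) ξ := by
        intro ξ
        rw [← mul_assoc, ← Complex.ofReal_mul, ← weight_add]
        simp
      obtain ⟨f, hf⟩ := exists_sob_of_fourier (n := n) (s := r)
        (h := fun ξ => (weight (-r) ξ : ℂ) * (𝓕 g : L2C n) ξ) h0
        ((Complex.measurable_ofReal.comp (measurable_weight (-r))).mul
          (Lp.stronglyMeasurable _).measurable).aestronglyMeasurable
        ((hermitian_ofReal fun ξ => weight_neg_arg (-r) ξ).mul hH)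
        (by simp only [e]; exact Lp.memLp _)
      refine ⟨f, ?_⟩
      apply (Lp.fourierTransformₗᵢ (Rn n) ℂ).injective
      change 𝓕 f.bessel = 𝓕 g
      apply Lp.ext
      filter_upwards [fourier_bessel f, hf] with ξ a b
      rw [a, b, e]
  rw [this]
  exact isClosed_eq (conjL n).continuous continuous_id

/-- Frequency truncation shows that `H^r'` is dense in `H^r` for `r' ≥ r ≥ 0`. -/
theorem denseRange_incl {n : ℕ} {r r' : ℝ} (h0 : 0 ≤ r) (h : r ≤ r') :
    DenseRange (incl h0 h : Sob n r' →L[ℝ] Sob n r) := by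
  rw [Metric.denseRange_iff]
  intro f ε hε
  let ind : ℕ → Rn n → ℝ := fun N => (Metric.closedBall (0 : Rn n) N).indicator 1
  have hind : ∀ N ξ, ind N ξ = if ‖ξ‖ ≤ N then 1 else 0 := by
    intro N ξ; simp [ind, indicator]
  have hindm : ∀ N, Measurable (ind N) := fun N =>
    measurable_one.indicator Metric.isClosed_closedBall.measurableSet
  have ex : ∀ N : ℕ, ∃ L : Sob n r →L[ℝ] Sob n r', ∀ f,
      fhat (L f).toL2 =ᵐ[volume] fun ξ => (ind N ξ : ℂ) * fhat f.toL2 ξ := by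
    intro N
    refine exists_multiplier (C := (1 + (N : ℝ) ^ 2) ^ ((r' - r) / 2))
      (Complex.measurable_ofReal.comp (hindm N))
      (hermitian_ofReal fun ξ => by simp [hind]) (h0.trans h) fun ξ => ?_
    rw [Complex.norm_real, hind]
    split_ifs with hN
    · have h1 : weight (r' - r) ξ ≤ (1 + (N : ℝ) ^ 2) ^ ((r' - r) / 2) := by
        unfold weight
        apply Real.rpow_le_rpow (by positivity) _ (by linarith)
        gcongr
      have h2 : weight (r' - r) ξ * weight (r - r') ξ = 1 := by
        rw [← weight_add]; simp
      have h3 := (weight_pos (r - r') ξ).le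
      rw [norm_one]
      calc (1 : ℝ) = weight (r' - r) ξ * weight (r - r') ξ := h2.symm
        _ ≤ _ := mul_le_mul_of_nonneg_right h1 h3
    · have := (weight_pos (r - r') ξ).le
      rw [norm_zero]; positivity
  choose L hL using ex
  have hlim : Tendsto (fun N => ‖f - incl h0 h (L N f)‖ₑ ^ 2) atTop (𝓝 0) := by
    have hnorm : ∀ N, ‖f - incl h0 h (L N f)‖ₑ ^ 2 =
        ∫⁻ ξ, ‖((1 - ind N ξ : ℝ) : ℂ) * ((weight r ξ : ℂ) * fhat f.toL2 ξ)‖ₑ ^ 2 := by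
      intro N
      rw [Sob.enorm_eq, ← eLpNorm_two_sq]
      congr 1
      apply eLpNorm_congr_ae
      rw [map_sub, toL2_incl]
      filter_upwards [fhat_sub_ae f.toL2 (L N f).toL2, hL N f] with ξ a b
      rw [a, b]
      push_cast
      ring
    simp only [hnorm]
    have h0 : (0 : ℝ≥0∞) = ∫⁻ _ : Rn n, 0 := by simp
    rw [h0]
    have hm : Measurable fun ξ => (weight r ξ : ℂ) * fhat f.toL2 ξ :=
      (Complex.measurable_ofReal.comp (measurable_weight r)).mul (measurable_fhat _)
    refine tendsto_lintegral_of_dominated_convergence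
      (fun ξ => ‖(weight r ξ : ℂ) * fhat f.toL2 ξ‖ₑ ^ 2) (fun N => ?_) (fun N => ?_) ?_ ?_
    · exact ((Complex.measurable_ofReal.comp (measurable_const.sub (hindm N))).mul
        hm).enorm.pow_const 2
    · refine Eventually.of_forall fun ξ => ?_
      dsimp only
      gcongr
      rw [enorm_mul, hind]
      refine mul_le_of_le_one_left' ?_
      split_ifs <;> simp
    · rw [← eLpNorm_two_sq]
      exact ENNReal.pow_ne_top f.memLp.2.ne
    · refine Eventually.of_forall fun ξ => ?_
      apply tendsto_const_nhds.congr'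
      filter_upwards [eventually_ge_atTop ⌈‖ξ‖⌉₊] with N hN
      rw [hind, if_pos (Nat.ceil_le.mp hN)]
      simp
  have h2 : (0 : ℝ≥0∞) < ENNReal.ofReal ε ^ 2 := by positivity
  obtain ⟨N, hN⟩ := (hlim.eventually (gt_mem_nhds h2)).exists
  refine ⟨L N f, ?_⟩
  rw [dist_eq_norm]
  have h3 : ‖f - incl h0 h (L N f)‖ₑ < ENNReal.ofReal ε := lt_of_pow_lt_pow_left' 2 hN
  rw [← ofReal_norm] at h3
  exact (ENNReal.ofReal_lt_ofReal_iff hε).mp h3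

/-! ### Convolution inequalities -/

/-- Young's inequality `L¹ * L² ⊂ L²` for nonnegative functions. -/
theorem lintegral_conv_sq_le {n : ℕ} {a b : Rn n → ℝ≥0∞} (ha : Measurable a) (hb : Measurable b) :
    ∫⁻ ξ, (∫⁻ η, a η * b (ξ - η)) ^ 2 ≤ (∫⁻ η, a η) ^ 2 * ∫⁻ ξ, b ξ ^ 2 := by
  have h1 : ∀ ξ, (∫⁻ η, a η * b (ξ - η)) ^ 2 ≤
      (∫⁻ η, a η) * ∫⁻ η, a η * b (ξ - η) ^ 2 := by
    intro ξ
    have hm : Measurable fun η => b (ξ - η) := hb.comp (by fun_prop)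
    have hh := ENNReal.lintegral_mul_le_Lp_mul_Lq (volume : Measure (Rn n))
      Real.HolderConjugate.two_two
      (f := fun η => a η ^ (1 / 2 : ℝ)) (g := fun η => a η ^ (1 / 2 : ℝ) * b (ξ - η))
      (ha.pow_const _).aemeasurable ((ha.pow_const _).mul hm).aemeasurable
    have e0 : ∀ x : ℝ≥0∞, x ^ (1 / 2 : ℝ) * x ^ (1 / 2 : ℝ) = x := by
      intro x
      rw [← ENNReal.rpow_add_of_nonneg _ _ (by norm_num) (by norm_num)]
      norm_num
    have e1 : ∀ x : ℝ≥0∞, (x ^ (1 / 2 : ℝ)) ^ (2 : ℝ) = x := by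
      intro x; rw [← ENNReal.rpow_mul]; norm_num
    simp only [Pi.mul_apply, ← mul_assoc, e0, ENNReal.mul_rpow_of_nonneg _ _ zero_le_two, e1] at hh
    have e2 : ∀ x : ℝ≥0∞, (x ^ (1 / 2 : ℝ)) ^ 2 = x := by
      intro x; rw [← ENNReal.rpow_natCast, ← ENNReal.rpow_mul]; norm_num
    calc _ ≤ ((∫⁻ η, a η) ^ (1 / 2 : ℝ) *
          (∫⁻ η, a η * b (ξ - η) ^ (2 : ℝ)) ^ (1 / 2 : ℝ)) ^ 2 := by gcongr
      _ = _ := by rw [mul_pow, e2, e2]; simp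
  calc _ ≤ ∫⁻ ξ, (∫⁻ η, a η) * ∫⁻ η, a η * b (ξ - η) ^ 2 := lintegral_mono h1
    _ = (∫⁻ η, a η) * ∫⁻ ξ, ∫⁻ η, a η * b (ξ - η) ^ 2 := by
      rw [lintegral_const_mul]
      apply Measurable.lintegral_prod_right'
        (f := fun p : Rn n × Rn n => a p.2 * b (p.1 - p.2) ^ 2)
      have := hb.comp (measurable_fst.sub measurable_snd : Measurable fun p : Rn n × Rn n => _)
      exact (ha.comp measurable_snd).mul (this.pow_const 2)
    _ = (∫⁻ η, a η) * ∫⁻ η, ∫⁻ ξ, a η * b (ξ - η) ^ 2 := by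
      rw [lintegral_lintegral_swap]
      have := hb.comp (measurable_fst.sub measurable_snd : Measurable fun p : Rn n × Rn n => _)
      exact ((ha.comp measurable_snd).mul (this.pow_const 2)).aemeasurable
    _ = (∫⁻ η, a η) * ∫⁻ η, a η * ∫⁻ ξ, b ξ ^ 2 := by
      congr 1
      apply lintegral_congr fun η => ?_
      have hm : Measurable fun ξ => b (ξ - η) ^ 2 :=
        Measurable.pow_const (hb.comp (measurable_id.sub_const η)) 2
      rw [lintegral_const_mul _ hm]
      rw [lintegral_sub_right_eq_self (fun ξ => b ξ ^ 2) η]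
    _ = _ := by rw [lintegral_mul_const _ ha, sq, mul_assoc]

/-- The convolution of complex functions. -/
def conv {n : ℕ} (F G : Rn n → ℂ) : Rn n → ℂ := F ⋆[ContinuousLinearMap.mul ℂ ℂ] G

theorem conv_apply {n : ℕ} (F G : Rn n → ℂ) (ξ : Rn n) :
    conv F G ξ = ∫ η, F η * G (ξ - η) := rfl

theorem enorm_conv_le {n : ℕ} (F G : Rn n → ℂ) (ξ : Rn n) :
    ‖conv F G ξ‖ₑ ≤ ∫⁻ η, ‖F η‖ₑ * ‖G (ξ - η)‖ₑ := by
  rw [conv_apply]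
  refine (enorm_integral_le_lintegral_enorm _).trans (le_of_eq ?_)
  simp only [enorm_mul]

theorem aestronglyMeasurable_conv {n : ℕ} {F G : Rn n → ℂ} (hF : Integrable F)
    (hG : Integrable G) : AEStronglyMeasurable (conv F G) volume :=
  (hF.integrable_convolution (ContinuousLinearMap.mul ℂ ℂ) hG).aestronglyMeasurable

/-- A version of the Peetre inequality: one of the two frequencies `η`, `ξ - η` is at least half of
`ξ`. -/
theorem weight_le_add {n : ℕ} {r : ℝ} (hr : 0 ≤ r) (ξ η : Rn n) :
    weight r ξ ≤ 4 ^ (r / 2) * (weight r η + weight r (ξ - η)) := by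
  have key : ∀ a b : Rn n, ‖a‖ ≤ ‖b‖ → weight r (a + b) ≤ 4 ^ (r / 2) * weight r b := by
    intro a b hab
    unfold weight
    rw [← Real.mul_rpow (by norm_num) (by positivity)]
    apply Real.rpow_le_rpow (by positivity) _ (by positivity)
    have := norm_add_le a b
    nlinarith [norm_nonneg a, norm_nonneg b, norm_nonneg (a + b)]
  have p1 := weight_pos r η
  have p2 := weight_pos r (ξ - η)
  have p3 : (0 : ℝ) < 4 ^ (r / 2) := by positivity
  rcases le_total ‖η‖ ‖ξ - η‖ with h | h
  · have := key _ _ h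
    rw [add_sub_cancel] at this
    nlinarith
  · have := key _ _ h
    rw [sub_add_cancel] at this
    nlinarith

/-- The weighted `L²` bound for a convolution, which underlies the algebra property of `H^r`. -/
theorem eLpNorm_weight_conv_le {n : ℕ} {r : ℝ} (hr : 0 ≤ r) {F G : Rn n → ℂ}
    (hF : Measurable F) (hG : Measurable G) :
    eLpNorm (fun ξ => (weight r ξ : ℂ) * conv F G ξ) 2 volume ≤
      ENNReal.ofReal (2 * 4 ^ (r / 2)) *
      ((∫⁻ ξ, ‖G ξ‖ₑ) * eLpNorm (fun ξ => (weight r ξ : ℂ) * F ξ) 2 volume +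
        (∫⁻ ξ, ‖F ξ‖ₑ) * eLpNorm (fun ξ => (weight r ξ : ℂ) * G ξ) 2 volume) := by
  set c : ℝ≥0∞ := ENNReal.ofReal (4 ^ (r / 2)) with hc
  have hwm : Measurable fun ξ : Rn n => (weight r ξ : ℂ) :=
    Complex.measurable_ofReal.comp (measurable_weight r)
  set f : Rn n → ℝ≥0∞ := fun ξ => ‖F ξ‖ₑ with hf
  set g : Rn n → ℝ≥0∞ := fun ξ => ‖G ξ‖ₑ with hg
  set wf : Rn n → ℝ≥0∞ := fun ξ => ‖(weight r ξ : ℂ) * F ξ‖ₑ with hwf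
  set wg : Rn n → ℝ≥0∞ := fun ξ => ‖(weight r ξ : ℂ) * G ξ‖ₑ with hwg
  have mf : Measurable f := hF.enorm
  have mg : Measurable g := hG.enorm
  have mwf : Measurable wf := (hwm.mul hF).enorm
  have mwg : Measurable wg := (hwm.mul hG).enorm
  set A : Rn n → ℝ≥0∞ := fun ξ => ∫⁻ η, g η * wf (ξ - η) with hA
  set B' : Rn n → ℝ≥0∞ := fun ξ => ∫⁻ η, f η * wg (ξ - η) with hB
  have hw : ∀ ξ : Rn n, ‖(weight r ξ : ℂ)‖ₑ = ENNReal.ofReal (weight r ξ) := by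
    intro ξ
    rw [← ofReal_norm, Complex.norm_real, Real.norm_of_nonneg (weight_pos r ξ).le]
  have pt : ∀ ξ, ‖(weight r ξ : ℂ) * conv F G ξ‖ₑ ≤ c * (A ξ + B' ξ) := by
    intro ξ
    have hm1 : Measurable fun η => wf η * g (ξ - η) := mwf.mul (mg.comp (by fun_prop))
    have hm2 : Measurable fun η => f η * wg (ξ - η) := mf.mul (mwg.comp (by fun_prop))
    have hm3 : Measurable fun η => f η * g (ξ - η) := mf.mul (mg.comp (by fun_prop))
    have swap : A ξ = ∫⁻ η, wf η * g (ξ - η) := by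
      rw [hA]
      dsimp only
      rw [← lintegral_sub_left_eq_self (fun η => wf η * g (ξ - η)) ξ]
      simp only [sub_sub_cancel, mul_comm]
    rw [enorm_mul]
    calc _ ≤ ‖(weight r ξ : ℂ)‖ₑ * ∫⁻ η, f η * g (ξ - η) := by gcongr; exact enorm_conv_le F G ξ
      _ = ∫⁻ η, ‖(weight r ξ : ℂ)‖ₑ * (f η * g (ξ - η)) := (lintegral_const_mul _ hm3).symm
      _ ≤ ∫⁻ η, c * (wf η * g (ξ - η) + f η * wg (ξ - η)) := by
        refine lintegral_mono fun η => ?_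
        have h1 : ‖(weight r ξ : ℂ)‖ₑ ≤
            c * (‖(weight r η : ℂ)‖ₑ + ‖(weight r (ξ - η) : ℂ)‖ₑ) := by
          rw [hw, hw, hw, hc, ← ENNReal.ofReal_add (weight_pos r _).le (weight_pos r _).le,
            ← ENNReal.ofReal_mul (by positivity)]
          exact ENNReal.ofReal_le_ofReal (weight_le_add hr ξ η)
        calc _ ≤ c * (‖(weight r η : ℂ)‖ₑ + ‖(weight r (ξ - η) : ℂ)‖ₑ) *
              (f η * g (ξ - η)) := by gcongr
          _ = _ := by
            simp only [hwf, hwg, hf, hg, enorm_mul]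
            ring
      _ = c * (A ξ + B' ξ) := by
        rw [lintegral_const_mul' _ _ ENNReal.ofReal_ne_top, lintegral_add_left hm1, swap]
  have young : ∀ {a b : Rn n → ℝ≥0∞}, Measurable a → Measurable b →
      ∫⁻ ξ, (∫⁻ η, a η * b (ξ - η)) ^ 2 ≤ (∫⁻ η, a η) ^ 2 * ∫⁻ ξ, b ξ ^ 2 :=
    fun ha hb => lintegral_conv_sq_le ha hb
  have sqle : ∀ x y : ℝ≥0∞, (x + y) ^ 2 ≤ 2 * (x ^ 2 + y ^ 2) := by
    intro x y
    have := ENNReal.rpow_add_le_mul_rpow_add_rpow x y (p := 2) one_le_two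
    have e : (2 : ℝ≥0∞) ^ ((2 : ℝ) - 1) = 2 := by norm_num
    rw [e] at this
    simpa using this
  have mA : Measurable fun ξ => A ξ ^ 2 := by
    apply Measurable.pow_const
    apply Measurable.lintegral_prod_right' (f := fun p : Rn n × Rn n => g p.2 * wf (p.1 - p.2))
    have := mwf.comp (measurable_fst.sub measurable_snd : Measurable fun p : Rn n × Rn n => _)
    exact (mg.comp measurable_snd).mul this
  set P := (∫⁻ ξ, g ξ) * eLpNorm (fun ξ => (weight r ξ : ℂ) * F ξ) 2 volume with hP
  set Q := (∫⁻ ξ, f ξ) * eLpNorm (fun ξ => (weight r ξ : ℂ) * G ξ) 2 volume with hQ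
  have hsq : eLpNorm (fun ξ => (weight r ξ : ℂ) * conv F G ξ) 2 volume ^ 2 ≤
      (ENNReal.ofReal (2 * 4 ^ (r / 2)) * (P + Q)) ^ 2 := by
    rw [eLpNorm_two_sq]
    calc _ ≤ ∫⁻ ξ, 2 * c ^ 2 * (A ξ ^ 2 + B' ξ ^ 2) := by
          refine lintegral_mono fun ξ => ?_
          calc _ ≤ (c * (A ξ + B' ξ)) ^ 2 := by gcongr; exact pt ξ
            _ = c ^ 2 * (A ξ + B' ξ) ^ 2 := mul_pow _ _ _
            _ ≤ c ^ 2 * (2 * (A ξ ^ 2 + B' ξ ^ 2)) := by gcongr; exact sqle _ _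
            _ = _ := by ring
      _ = 2 * c ^ 2 * (∫⁻ ξ, A ξ ^ 2 + B' ξ ^ 2) := by
          rw [lintegral_const_mul']
          exact ENNReal.mul_ne_top (by simp) (by simp [hc])
      _ = 2 * c ^ 2 * ((∫⁻ ξ, A ξ ^ 2) + ∫⁻ ξ, B' ξ ^ 2) := by rw [lintegral_add_left mA]
      _ ≤ 2 * c ^ 2 * (P ^ 2 + Q ^ 2) := by
          gcongr
          · refine (young mg mwf).trans (le_of_eq ?_)
            rw [hP, mul_pow, eLpNorm_two_sq]
          · refine (young mf mwg).trans (le_of_eq ?_)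
            rw [hQ, mul_pow, eLpNorm_two_sq]
      _ ≤ 2 * c ^ 2 * (2 * (P + Q) ^ 2) := by
          gcongr
          calc P ^ 2 + Q ^ 2 ≤ (P + Q) ^ 2 + (P + Q) ^ 2 := by gcongr <;> simp
            _ = _ := by ring
      _ = _ := by
          rw [ENNReal.ofReal_mul zero_le_two, ← hc]
          simp only [ENNReal.ofReal_ofNat]
          ring
  exact (ENNReal.pow_le_pow_left_iff two_ne_zero).mp hsq

/-! ### Sobolev embedding and products -/

/-- The constant `‖(1 + |ξ|²)^(-r/2)‖_{L²}` of the embedding of `H^r` into the functions with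
integrable Fourier transform. -/
def embConst (n : ℕ) (r : ℝ) : ℝ≥0∞ :=
  eLpNorm (fun ξ : Rn n => (weight (-r) ξ : ℂ)) 2 volume

theorem embConst_lt_top {n : ℕ} {r : ℝ} (hr : (n : ℝ) / 2 < r) : embConst n r < ⊤ := by
  have h1 : embConst n r ^ 2 < ⊤ := by
    rw [embConst, eLpNorm_two_sq]
    have hn : (Module.finrank ℝ (Rn n) : ℝ) < 2 * r := by
      rw [finrank_euclideanSpace_fin]; linarith
    refine lt_of_le_of_lt (lintegral_mono fun ξ => ?_)
      (integrable_rpow_neg_one_add_norm_sq (μ := (volume : Measure (Rn n))) hn).2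
    rw [← enorm_pow, ← Complex.ofReal_pow]
    apply le_of_eq
    have e : weight (-r) ξ ^ 2 = (1 + ‖ξ‖ ^ 2) ^ (-(2 * r) / 2) := by
      rw [weight, ← Real.rpow_mul_natCast (by positivity)]
      congr 1
      push_cast
      ring
    rw [e, ← ofReal_norm, ← ofReal_norm, Complex.norm_real]
  exact (ENNReal.pow_lt_top_iff.mp h1).resolve_right two_ne_zero

/-- The `L¹` norm of the Fourier transform is controlled by the `H^r` norm (the constant is finite
for `r > n/2`). -/
theorem lintegral_fhat_le {n : ℕ} {r : ℝ} (f : Sob n r) :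
    ∫⁻ ξ, ‖fhat f.toL2 ξ‖ₑ ≤ embConst n r * ‖f‖ₑ := by
  have e : (fhat f.toL2 : Rn n → ℂ) =
      (fun ξ : Rn n => (weight (-r) ξ : ℂ)) • fun ξ => (weight r ξ : ℂ) * fhat f.toL2 ξ := by
    ext ξ
    simp only [Pi.smul_apply', smul_eq_mul]
    rw [← mul_assoc, ← Complex.ofReal_mul, ← weight_add]
    simp
  rw [Sob.enorm_eq, ← eLpNorm_one_eq_lintegral_enorm, embConst]
  conv_lhs => rw [e]
  exact eLpNorm_smul_le_mul_eLpNorm (p := 2) (q := 2) (r := 1)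
    f.memLp.aestronglyMeasurable
    (Complex.measurable_ofReal.comp (measurable_weight _)).aestronglyMeasurable

theorem integrable_fhat {n : ℕ} {r : ℝ} (hr : (n : ℝ) / 2 < r) (f : Sob n r) :
    Integrable (fhat f.toL2) := by
  refine ⟨(measurable_fhat _).aestronglyMeasurable, ?_⟩
  exact (lintegral_fhat_le f).trans_lt
    (ENNReal.mul_lt_top (embConst_lt_top hr) enorm_lt_top)

theorem toComplex_ae_eq_fourierInv {n : ℕ} {f : L2R n} (h : Integrable (fhat f)) :
    toComplex n f =ᵐ[volume] 𝓕⁻ (fhat f : Rn n → ℂ) := by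
  have := fourierInv_toLp_ae_eq h (memLp_fhat f)
  rw [Lp.toLp_coeFn, fhat_apply, FourierTransform.fourierInv_fourier_eq] at this
  exact this

theorem ae_enorm_le {n : ℕ} {f : L2R n} (h : Integrable (fhat f)) :
    ∀ᵐ x, ‖f x‖ₑ ≤ ∫⁻ ξ, ‖fhat f ξ‖ₑ := by
  filter_upwards [toComplex_ae_eq_fourierInv h, toComplex_ae f] with x h1 h2
  have h3 : ‖f x‖ₑ = ‖toComplex n f x‖ₑ := by
    rw [h2, ← ofReal_norm, ← ofReal_norm, Complex.norm_real]
  rw [h3, h1, Real.fourierInv_eq]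
  refine (enorm_integral_le_lintegral_enorm _).trans (le_of_eq ?_)
  apply lintegral_congr fun ξ => ?_
  rw [← ofReal_norm, ← ofReal_norm, Circle.norm_smul]

/-- Sobolev's embedding `H^r ⊂ L^∞` for `r > n/2`. -/
theorem ae_norm_le {n : ℕ} {r : ℝ} (hr : (n : ℝ) / 2 < r) (f : Sob n r) :
    ∀ᵐ x, ‖f.toL2 x‖ ≤ (embConst n r).toReal * ‖f‖ := by
  filter_upwards [ae_enorm_le (integrable_fhat hr f)] with x h
  have := h.trans (lintegral_fhat_le f)
  rw [← ofReal_norm, ← ofReal_norm, ← ENNReal.ofReal_toReal (embConst_lt_top hr).ne,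
    ← ENNReal.ofReal_mul ENNReal.toReal_nonneg] at this
  exact (ENNReal.ofReal_le_ofReal_iff (by positivity)).mp this

theorem memLp_mul {n : ℕ} {r : ℝ} (hr : (n : ℝ) / 2 < r) (f : Sob n r) (g : L2R n) :
    MemLp (fun x => f.toL2 x * g x) 2 volume := by
  refine (Lp.memLp g).of_le_mul (c := (embConst n r).toReal * ‖f‖)
    ((Lp.aestronglyMeasurable _).mul (Lp.aestronglyMeasurable _)) ?_
  filter_upwards [ae_norm_le hr f] with x h
  rw [norm_mul]
  gcongr

theorem mulL2_ae {n : ℕ} {f g : L2R n} (h : MemLp (fun x => f x * g x) 2 volume) :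
    mulL2 f g =ᵐ[volume] fun x => f x * g x := mkL2_ae h

theorem mulL2_comm {n : ℕ} (f g : L2R n) : mulL2 f g = mulL2 g f := by
  simp only [mulL2, mul_comm]

/-- Multiplication `H^r × L² → L²` for `r > n/2`. -/
theorem exists_mulLow {n : ℕ} {r : ℝ} (hr : (n : ℝ) / 2 < r) :
    ∃ L : Sob n r →L[ℝ] L2R n →L[ℝ] L2R n, ∀ f g, L f g = mulL2 f.toL2 g := by
  have h : ∀ (f : Sob n r) (g : L2R n), _ := fun f g => mulL2_ae (memLp_mul hr f g)
  refine ⟨LinearMap.mkContinuous₂ (LinearMap.mk₂ ℝ (fun f g => mulL2 f.toL2 g)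
    (fun f f' g => ?_) (fun c f g => ?_) (fun f g g' => ?_) fun c f g => ?_)
    (embConst n r).toReal fun f g => ?_, fun f g => rfl⟩
  · apply Lp.ext
    filter_upwards [h (f + f') g, h f g, h f' g, Lp.coeFn_add f.toL2 f'.toL2,
      Lp.coeFn_add (mulL2 f.toL2 g) (mulL2 f'.toL2 g)] with x a b c d e
    rw [a, e, map_add, Pi.add_apply, d, Pi.add_apply, b, c]; ring
  · apply Lp.ext
    filter_upwards [h (c • f) g, h f g, Lp.coeFn_smul c f.toL2,
      Lp.coeFn_smul c (mulL2 f.toL2 g)] with x a b d e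
    rw [a, e, map_smul, Pi.smul_apply, d, Pi.smul_apply, b]; simp; ring
  · apply Lp.ext
    filter_upwards [h f (g + g'), h f g, h f g', Lp.coeFn_add g g',
      Lp.coeFn_add (mulL2 f.toL2 g) (mulL2 f.toL2 g')] with x a b c d e
    rw [a, e, Pi.add_apply, d, Pi.add_apply, b, c]; ring
  · apply Lp.ext
    filter_upwards [h f (c • g), h f g, Lp.coeFn_smul c g,
      Lp.coeFn_smul c (mulL2 f.toL2 g)] with x a b d e
    rw [a, e, Pi.smul_apply, d, Pi.smul_apply, b]; simp; ring
  · refine Lp.norm_le_mul_norm_of_ae_le_mul ?_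
    filter_upwards [h f g, ae_norm_le hr f] with x a b
    simp only [LinearMap.mk₂_apply]
    rw [a, norm_mul]
    gcongr

/-- Multiplication `H^r × L² → L²` for `r > n/2`. -/
def mulLow {n : ℕ} {r : ℝ} (hr : (n : ℝ) / 2 < r) : Sob n r →L[ℝ] L2R n →L[ℝ] L2R n :=
  (exists_mulLow hr).choose

theorem mulLow_apply {n : ℕ} {r : ℝ} (hr : (n : ℝ) / 2 < r) (f : Sob n r) (g : L2R n) :
    mulLow hr f g = mulL2 f.toL2 g := (exists_mulLow hr).choose_spec f g

theorem memLp_conv {n : ℕ} {F G : Rn n → ℂ} (hF : Measurable F) (hG : Measurable G)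
    (iF : Integrable F) (iG : Integrable G) {r : ℝ} (hr : 0 ≤ r)
    (wF : MemLp (fun ξ => (weight r ξ : ℂ) * F ξ) 2 volume)
    (wG : MemLp (fun ξ => (weight r ξ : ℂ) * G ξ) 2 volume) :
    MemLp (fun ξ => (weight r ξ : ℂ) * conv F G ξ) 2 volume := by
  refine ⟨(Complex.measurable_ofReal.comp (measurable_weight r)).aestronglyMeasurable.mul
    (aestronglyMeasurable_conv iF iG), (eLpNorm_weight_conv_le hr hF hG).trans_lt ?_⟩
  refine ENNReal.mul_lt_top ENNReal.ofReal_lt_top (ENNReal.add_lt_top.mpr ⟨?_, ?_⟩)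
  · exact ENNReal.mul_lt_top iG.2 wF.2
  · exact ENNReal.mul_lt_top iF.2 wG.2

/-- The Fourier transform turns products into convolutions. -/
theorem fhat_mulL2 {n : ℕ} {f g : L2R n} (hf : Integrable (fhat f)) (hg : Integrable (fhat g)) :
    fhat (mulL2 f g) =ᵐ[volume] conv (fhat f) (fhat g) := by
  have hi : Integrable (conv (fhat f) (fhat g)) :=
    hf.integrable_convolution (ContinuousLinearMap.mul ℂ ℂ) hg
  have h2 : MemLp (conv (fhat f) (fhat g)) 2 volume := by
    have := memLp_conv (measurable_fhat f) (measurable_fhat g) hf hg le_rfl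
      (by simpa using memLp_fhat f) (by simpa using memLp_fhat g)
    simpa using this
  have hprod : (𝓕⁻ (h2.toLp _ : L2C n) : L2C n) =ᵐ[volume]
      fun x => ((f x * g x : ℝ) : ℂ) := by
    filter_upwards [fourierInv_toLp_ae_eq hi h2, toComplex_ae_eq_fourierInv hf, toComplex_ae f,
      toComplex_ae_eq_fourierInv hg, toComplex_ae g] with x a b c d e
    rw [a, Real.fourierInv_eq_fourier_neg, conv, Real.fourier_mul_convolution_eq hf hg,
      ← Real.fourierInv_eq_fourier_neg, ← Real.fourierInv_eq_fourier_neg, ← b, ← d, c, e]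
    simp
  have hm : MemLp (fun x => f x * g x) 2 volume := by
    have := (memLp_congr_ae hprod).mp (Lp.memLp _)
    simpa using this.re
  have : toComplex n (mulL2 f g) = 𝓕⁻ (h2.toLp _ : L2C n) := by
    apply Lp.ext
    filter_upwards [hprod, toComplex_ae (mulL2 f g), mulL2_ae hm] with x a b c
    rw [a, b, c]
  rw [fhat_apply, this, FourierTransform.fourier_fourierInv_eq]
  exact h2.coeFn_toLp

/-- `H^r` is an algebra for `r > n/2`. -/
theorem exists_mulS {n : ℕ} {r : ℝ} (hr : (n : ℝ) / 2 < r) :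
    ∃ L : Sob n r →L[ℝ] Sob n r →L[ℝ] Sob n r, ∀ f g, (L f g).toL2 = mulL2 f.toL2 g.toL2 := by
  have h0 : 0 ≤ r := le_trans (by positivity) hr.le
  have mem : ∀ f g : Sob n r, mulL2 f.toL2 g.toL2 ∈ sobolevSubmodule n r := by
    intro f g
    rw [mem_sobolev_iff]
    refine (memLp_congr_ae ?_).mp (memLp_conv (measurable_fhat _) (measurable_fhat _)
      (integrable_fhat hr f) (integrable_fhat hr g) h0 f.memLp g.memLp)
    filter_upwards [fhat_mulL2 (integrable_fhat hr f) (integrable_fhat hr g)] with x h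
    rw [h]
  let p : Sob n r → Sob n r → Sob n r := fun f g => ⟨mulL2 f.toL2 g.toL2, mem f g⟩
  have hp : ∀ f g, (p f g).toL2 = mulLow hr f g.toL2 := fun f g => (mulLow_apply hr f _).symm
  refine ⟨LinearMap.mkContinuous₂ (LinearMap.mk₂ ℝ p
    (fun f f' g => ?_) (fun c f g => ?_) (fun f g g' => ?_) fun c f g => ?_)
    (2 * (2 * 4 ^ (r / 2)) * (embConst n r).toReal) fun f g => ?_, fun f g => rfl⟩
  · apply Sob.toL2_injective; simp [hp]
  · apply Sob.toL2_injective; simp [hp]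
  · apply Sob.toL2_injective; simp [hp]
  · apply Sob.toL2_injective; simp [hp]
  · simp only [LinearMap.mk₂_apply]
    have h1 : ‖p f g‖ₑ ≤ ENNReal.ofReal (2 * 4 ^ (r / 2)) *
        ((embConst n r * ‖g‖ₑ) * ‖f‖ₑ + (embConst n r * ‖f‖ₑ) * ‖g‖ₑ) := by
      have e : ‖p f g‖ₑ = eLpNorm (fun ξ => (weight r ξ : ℂ) *
          conv (fhat f.toL2) (fhat g.toL2) ξ) 2 volume := by
        rw [Sob.enorm_eq]
        apply eLpNorm_congr_ae
        filter_upwards [fhat_mulL2 (integrable_fhat hr f) (integrable_fhat hr g)] with x h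
        change (weight r x : ℂ) * fhat (mulL2 f.toL2 g.toL2) x = _
        rw [h]
      rw [e]
      refine (eLpNorm_weight_conv_le h0 (measurable_fhat _) (measurable_fhat _)).trans ?_
      rw [← Sob.enorm_eq, ← Sob.enorm_eq]
      gcongr
      · exact lintegral_fhat_le g
      · exact lintegral_fhat_le f
    have h2 : ENNReal.ofReal (2 * 4 ^ (r / 2)) *
        ((embConst n r * ‖g‖ₑ) * ‖f‖ₑ + (embConst n r * ‖f‖ₑ) * ‖g‖ₑ) =
        ENNReal.ofReal (2 * (2 * 4 ^ (r / 2)) * (embConst n r).toReal * ‖f‖ * ‖g‖) := by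
      have hc : (0 : ℝ) ≤ 2 * 4 ^ (r / 2) := by positivity
      generalize (2 * 4 ^ (r / 2) : ℝ) = c at hc
      rw [← ofReal_norm, ← ofReal_norm, ENNReal.ofReal_mul (by positivity),
        ENNReal.ofReal_mul (by positivity), ENNReal.ofReal_mul (by positivity),
        ENNReal.ofReal_mul zero_le_two, ENNReal.ofReal_toReal (embConst_lt_top hr).ne]
      simp only [ENNReal.ofReal_ofNat]
      ring
    rw [h2, ← ofReal_norm] at h1
    exact (ENNReal.ofReal_le_ofReal_iff (by positivity)).mp h1

/-- Multiplication on `H^r` for `r > n/2`. -/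
def mulS {n : ℕ} {r : ℝ} (hr : (n : ℝ) / 2 < r) : Sob n r →L[ℝ] Sob n r →L[ℝ] Sob n r :=
  (exists_mulS hr).choose

@[simp] theorem toL2_mulS {n : ℕ} {r : ℝ} (hr : (n : ℝ) / 2 < r) (f g : Sob n r) :
    (mulS hr f g).toL2 = mulL2 f.toL2 g.toL2 := (exists_mulS hr).choose_spec f g

theorem dsymb_sub {n : ℕ} (k : Fin n) (ξ η : Rn n) :
    dsymb k (ξ - η) = dsymb k ξ - dsymb k η := by
  simp [dsymb]; ring

/-- The product rule when the derivatives of the factors have integrable Fourier transforms. -/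
theorem pderiv_mulL2_of_smooth {n : ℕ} (k : Fin n) {r : ℝ} (hr : (n : ℝ) / 2 + 1 < r)
    (f g : Sob n r) :
    pderiv k (mulL2 f.toL2 g.toL2) =
      mulL2 (pderiv k f.toL2) g.toL2 + mulL2 f.toL2 (pderiv k g.toL2) := by
  have hn : (0 : ℝ) ≤ n / 2 := by positivity
  have hr1 : (n : ℝ) / 2 < r := by linarith
  have hr2 : (n : ℝ) / 2 < r - 1 := by linarith
  have h0 : 0 ≤ r - 1 := by linarith
  have hle : r - 1 + 1 ≤ r := by linarith
  have if' : Integrable (fhat (pderiv k f.toL2)) := by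
    rw [← toL2_D k h0 hle]; exact integrable_fhat hr2 _
  have ig' : Integrable (fhat (pderiv k g.toL2)) := by
    rw [← toL2_D k h0 hle]; exact integrable_fhat hr2 _
  have if0 := integrable_fhat hr1 f
  have ig0 := integrable_fhat hr1 g
  apply ext_fhat
  rw [← toL2_mulS hr1]
  have af := fhat_pderiv k (by linarith : 1 ≤ r) f
  have ag := fhat_pderiv k (by linarith : 1 ≤ r) g
  have ec : ∀ {F F' G G' : Rn n → ℂ}, F =ᵐ[volume] F' → G =ᵐ[volume] G' →
      ∀ ξ, conv F G ξ = conv F' G' ξ := by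
    intro F F' G G' hF hG ξ
    rw [conv_apply, conv_apply]
    apply integral_congr_ae
    have hq : Measure.QuasiMeasurePreserving (fun η : Rn n => ξ - η) volume volume :=
      (Measure.measurePreserving_sub_left (volume : Measure (Rn n)) ξ).quasiMeasurePreserving
    filter_upwards [hF, hq.ae hG] with η a b
    rw [a, b]
  filter_upwards [fhat_pderiv k (by linarith : 1 ≤ r) (mulS hr1 f g),
    fhat_mulL2 if0 ig0, fhat_mulL2 if' ig0, fhat_mulL2 if0 ig',
    fhat_add_ae (mulL2 (pderiv k f.toL2) g.toL2) (mulL2 f.toL2 (pderiv k g.toL2)),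
    if'.ae_convolution_exists (ContinuousLinearMap.mul ℂ ℂ) ig0,
    if0.ae_convolution_exists (ContinuousLinearMap.mul ℂ ℂ) ig'] with ξ h1 h2 h3 h4 h5 e1 e2
  rw [h1, toL2_mulS, h2, h5, h3, h4]
  rw [conv_apply, conv_apply, conv_apply, ← integral_const_mul]
  have e1' : Integrable fun η => fhat (pderiv k f.toL2) η * fhat g.toL2 (ξ - η) := e1
  have e2' : Integrable fun η => fhat f.toL2 η * fhat (pderiv k g.toL2) (ξ - η) := e2
  rw [← integral_add e1' e2']
  apply integral_congr_ae
  have hq : Measure.QuasiMeasurePreserving (fun η : Rn n => ξ - η) volume volume :=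
    (Measure.measurePreserving_sub_left (volume : Measure (Rn n)) ξ).quasiMeasurePreserving
  filter_upwards [af, hq.ae ag] with η a b
  rw [a, b, dsymb_sub]
  ring

/-- The product rule in `H^r` for `r > n/2`, `r ≥ 1`. -/
theorem pderiv_mulL2 {n : ℕ} (k : Fin n) {r : ℝ} (hr : (n : ℝ) / 2 < r) (hr1 : 1 ≤ r)
    (f g : Sob n r) :
    pderiv k (mulL2 f.toL2 g.toL2) =
      mulL2 (pderiv k f.toL2) g.toL2 + mulL2 f.toL2 (pderiv k g.toL2) := by
  have h0 : 0 ≤ r := by linarith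
  have hle : r ≤ r + 1 := by linarith
  let d : Sob n r →L[ℝ] L2R n :=
    (toL2L le_rfl).comp (D k (r' := 0) le_rfl (by linarith))
  have hd : ∀ f, d f = pderiv k f.toL2 := fun f => toL2_D k _ _ f
  have key : ∀ f g : Sob n r, d (mulS hr f g) = mulLow hr g (d f) + mulLow hr f (d g) := by
    intro f g
    refine DenseRange.induction_on₂ (denseRange_incl h0 hle)
      (p := fun f g => d (mulS hr f g) = mulLow hr g (d f) + mulLow hr f (d g)) ?_
      (fun f g => ?_) f g
    · apply isClosed_eq
      · exact d.continuous.comp (mulS hr).continuous₂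
      · have c1 : Continuous fun q : Sob n r × Sob n r => mulLow hr q.2 (d q.1) :=
          (mulLow hr).continuous₂.comp
            (continuous_snd.prodMk (d.continuous.comp continuous_fst))
        have c2 : Continuous fun q : Sob n r × Sob n r => mulLow hr q.1 (d q.2) :=
          (mulLow hr).continuous₂.comp
            (continuous_fst.prodMk (d.continuous.comp continuous_snd))
        exact c1.add c2
    · rw [hd, hd, hd, mulLow_apply, mulLow_apply, toL2_mulS]
      simp only [toL2_incl]
      rw [pderiv_mulL2_of_smooth k (by linarith : (n : ℝ) / 2 + 1 < r + 1), mulL2_comm g.toL2]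
  have := key f g
  rwa [hd, hd, hd, mulLow_apply, mulLow_apply, toL2_mulS, mulL2_comm g.toL2] at this

/-! ### Calculus in `L²` -/

/-- The partial derivative as a bounded operator `H^r → L²` for `r ≥ 1`. -/
def dL {n : ℕ} (k : Fin n) {r : ℝ} (h : 1 ≤ r) : Sob n r →L[ℝ] L2R n :=
  (toL2L le_rfl).comp (D k (r' := 0) le_rfl (by linarith))

theorem dL_apply {n : ℕ} (k : Fin n) {r : ℝ} (h : 1 ≤ r) (f : Sob n r) :
    dL k h f = pderiv k f.toL2 := toL2_D k _ _ f

theorem toL2_sum {n : ℕ} {r : ℝ} {ι : Type*} (t : Finset ι) (f : ι → Sob n r) :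
    (∑ i ∈ t, f i).toL2 = ∑ i ∈ t, (f i).toL2 := map_sum _ _ _

theorem pderiv_sum {n : ℕ} (k : Fin n) {r : ℝ} (h : 1 ≤ r) {ι : Type*} (t : Finset ι)
    (f : ι → Sob n r) : pderiv k (∑ i ∈ t, (f i).toL2) = ∑ i ∈ t, pderiv k (f i).toL2 := by
  rw [← toL2_sum, ← dL_apply k h, map_sum]
  simp only [dL_apply]

theorem pderiv_zero {n : ℕ} (k : Fin n) : pderiv k (0 : L2R n) = 0 := by
  have := (dL_apply k (le_refl (1 : ℝ)) (0 : Sob n 1)).symm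
  simpa using this

theorem mulL2_zero {n : ℕ} {r : ℝ} (hr : (n : ℝ) / 2 < r) (f : Sob n r) :
    mulL2 f.toL2 0 = 0 := by rw [← mulLow_apply hr, map_zero]

theorem mulL2_sum {n : ℕ} {r : ℝ} (hr : (n : ℝ) / 2 < r) (f : Sob n r) {ι : Type*}
    (t : Finset ι) (g : ι → L2R n) : mulL2 f.toL2 (∑ i ∈ t, g i) = ∑ i ∈ t, mulL2 f.toL2 (g i) := by
  rw [← mulLow_apply hr, map_sum]
  simp only [mulLow_apply]

theorem pderiv_comm {n : ℕ} (j k : Fin n) {r : ℝ} (h : 2 ≤ r) (f : Sob n r) :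
    pderiv j (pderiv k f.toL2) = pderiv k (pderiv j f.toL2) := by
  have h0 : (0 : ℝ) ≤ 1 := zero_le_one
  have h1 : (1 : ℝ) + 1 ≤ r := by linarith
  have hj := fhat_pderiv j le_rfl (D k h0 h1 f)
  have hk := fhat_pderiv k le_rfl (D j h0 h1 f)
  rw [toL2_D] at hj hk
  apply ext_fhat
  filter_upwards [hj, hk, fhat_pderiv k (by linarith : 1 ≤ r) f,
    fhat_pderiv j (by linarith : 1 ≤ r) f] with ξ a b c d
  rw [a, b, c, d]; ring

/-- Integration by parts against a test function. -/
theorem integral_mul_fderiv {n : ℕ} (k : Fin n) {r : ℝ} (h : 1 ≤ r) (f : Sob n r)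
    {φ : Rn n → ℝ} (hφ : ContDiff ℝ ∞ φ) (hc : HasCompactSupport φ) :
    ∫ x, f.toL2 x * fderiv ℝ φ x (stdVec k) = -∫ x, pderiv k f.toL2 x * φ x := by
  have hg₁ : HasCompactSupport (Complex.ofRealCLM ∘ φ) := hc.comp_left rfl
  have hg₂ : ContDiff ℝ ∞ (Complex.ofRealCLM ∘ φ) := by fun_prop
  have hd := (toDistr_eq_lineDeriv_iff k f.toL2 _).mpr (fhat_pderiv k h f)
  have hfd : ∀ x, ∂_{stdVec k} (hg₁.toSchwartzMap hg₂) x =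
      ((fderiv ℝ φ x (stdVec k) : ℝ) : ℂ) := by
    intro x
    rw [SchwartzMap.lineDerivOp_apply_eq_fderiv]
    change fderiv ℝ (Complex.ofRealCLM ∘ φ) x (stdVec k) = _
    rw [(Complex.ofRealCLM.hasFDerivAt.comp x
      ((hφ.differentiable (by simp)) x).hasFDerivAt).fderiv]
    simp
  have e := congrArg (fun T : 𝓢'(Rn n, ℂ) => T (hg₁.toSchwartzMap hg₂)) hd
  simp only [toDistr, TemperedDistribution.lineDerivOp_apply_apply, map_neg,
    Lp.toTemperedDistribution_apply] at e
  have e1 : ∫ x, (hg₁.toSchwartzMap hg₂) x • toComplex n (pderiv k f.toL2) x =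
      ((∫ x, pderiv k f.toL2 x * φ x : ℝ) : ℂ) := by
    rw [← integral_complex_ofReal]
    apply integral_congr_ae
    filter_upwards [toComplex_ae (pderiv k f.toL2)] with x hx
    rw [hx]; simp [mul_comm]
  have e2 : ∫ x, (∂_{stdVec k} (hg₁.toSchwartzMap hg₂)) x • toComplex n f.toL2 x =
      ((∫ x, f.toL2 x * fderiv ℝ φ x (stdVec k) : ℝ) : ℂ) := by
    rw [← integral_complex_ofReal]
    apply integral_congr_ae
    filter_upwards [toComplex_ae f.toL2] with x hx
    rw [hx, hfd]; simp [mul_comm]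
  rw [e1, e2, ← Complex.ofReal_neg] at e
  rw [Complex.ofReal_injective e, neg_neg]

theorem inner_toComplex {n : ℕ} (f g : L2R n) :
    inner ℂ (toComplex n f) (toComplex n g) = ((inner ℝ f g : ℝ) : ℂ) := by
  rw [L2.inner_def, L2.inner_def, ← integral_complex_ofReal]
  apply integral_congr_ae
  filter_upwards [toComplex_ae f, toComplex_ae g] with x a b
  rw [a, b]; simp

/-- Parseval's identity for real-valued functions. -/
theorem inner_fhat {n : ℕ} (f g : L2R n) :
    inner ℂ (fhat f) (fhat g) = ((inner ℝ f g : ℝ) : ℂ) := by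
  rw [fhat_apply, fhat_apply, Lp.inner_fourier_eq, inner_toComplex]

/-- The partial derivatives are skew-adjoint. -/
theorem inner_pderiv {n : ℕ} (k : Fin n) {r : ℝ} (h : 1 ≤ r) (f g : Sob n r) :
    inner ℝ (pderiv k f.toL2) g.toL2 = -inner ℝ f.toL2 (pderiv k g.toL2) := by
  apply Complex.ofReal_injective
  rw [Complex.ofReal_neg, ← inner_fhat, ← inner_fhat, L2.inner_def, L2.inner_def, ← integral_neg]
  apply integral_congr_ae
  filter_upwards [fhat_pderiv k h f, fhat_pderiv k h g] with ξ a b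
  rw [a, b]
  simp [dsymb, Complex.conj_ofNat]
  ring

theorem inner_mulL2 {n : ℕ} {r : ℝ} (hr : (n : ℝ) / 2 < r) (f : Sob n r) (g h : L2R n) :
    inner ℝ (mulL2 f.toL2 g) h = inner ℝ g (mulL2 f.toL2 h) := by
  rw [L2.inner_def, L2.inner_def]
  apply integral_congr_ae
  filter_upwards [mulL2_ae (memLp_mul hr f g), mulL2_ae (memLp_mul hr f h)] with x a b
  rw [a, b]
  simp
  ring

/-- A Fourier multiplier with a bounded symbol is bounded on `L²`. -/
theorem exists_multiplier_L2 {n : ℕ} {C : ℝ} {m : Rn n → ℂ} (hm : Measurable m)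
    (hH : Hermitian m) (hb : ∀ ξ, ‖m ξ‖ ≤ C) (f : L2R n) :
    ∃ g : L2R n, fhat g =ᵐ[volume] (fun ξ => m ξ * fhat f ξ) ∧ ‖g‖ ≤ C * ‖f‖ := by
  have hpt : ∀ ξ, ‖m ξ * fhat f ξ‖ ≤ C * ‖fhat f ξ‖ := by
    intro ξ
    rw [norm_mul]
    exact mul_le_mul_of_nonneg_right (hb ξ) (norm_nonneg _)
  have h2 : MemLp (fun ξ => m ξ * fhat f ξ) 2 volume :=
    (memLp_fhat f).of_le_mul (hm.mul (measurable_fhat f)).aestronglyMeasurable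
      (Eventually.of_forall hpt)
  have h3 := fhat_ofFourier h2 (hH.mul (hermitian_fhat f))
  refine ⟨_, h3, ?_⟩
  rw [← norm_fhat, ← norm_fhat f]
  refine Lp.norm_le_mul_norm_of_ae_le_mul ?_
  filter_upwards [h3] with ξ hξ
  rw [hξ]
  exact hpt ξ

/-- The divergence as a bounded operator. -/
def divL {n : ℕ} {r : ℝ} (h : 1 ≤ r) : VSob n r →L[ℝ] L2R n :=
  ∑ k, (dL k h).comp (ContinuousLinearMap.proj k)

theorem divL_apply {n : ℕ} {r : ℝ} (h : 1 ≤ r) (v : VSob n r) :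
    divL h v = divergence v.toL2 := by
  simp [divL, divergence, dL_apply, VSob.toL2]

theorem fhat_divergence {n : ℕ} {r : ℝ} (h : 1 ≤ r) (v : VSob n r) :
    fhat (divergence v.toL2) =ᵐ[volume] fun ξ => ∑ k, dsymb k ξ * fhat (v k).toL2 ξ := by
  have h1 : ∀ᵐ ξ, ∀ k, fhat (pderiv k (v k).toL2) ξ = dsymb k ξ * fhat (v k).toL2 ξ :=
    ae_all_iff.mpr fun k => fhat_pderiv k h (v k)
  filter_upwards [h1, fhat_sum_ae Finset.univ fun k => pderiv k (v k).toL2] with ξ a b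
  change fhat (∑ k, pderiv k (v k).toL2) ξ = _
  rw [b]
  exact Finset.sum_congr rfl fun k _ => a k

theorem sum_dsymb_sq {n : ℕ} (ξ : Rn n) :
    ∑ k, dsymb k ξ * dsymb k ξ = -((‖(2 * Real.pi) • ξ‖ ^ 2 : ℝ) : ℂ) := by
  have h1 : ∀ k, dsymb k ξ * dsymb k ξ = ((-(2 * Real.pi) ^ 2 * (ξ k) ^ 2 : ℝ) : ℂ) := by
    intro k
    unfold dsymb
    push_cast
    linear_combination (2 * Real.pi * (ξ k : ℂ)) ^ 2 * Complex.I_mul_I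
  rw [Finset.sum_congr rfl fun k _ => h1 k, ← Complex.ofReal_sum, ← Finset.mul_sum,
    ← EuclideanSpace.real_norm_sq_eq, norm_smul, Real.norm_of_nonneg (by positivity)]
  push_cast
  ring

theorem ae_ne_zero {n : ℕ} (hn : 0 < n) : ∀ᵐ ξ : Rn n, ξ ≠ 0 := by
  have : Nonempty (Fin n) := ⟨⟨0, hn⟩⟩
  exact compl_mem_ae_iff.mpr (measure_singleton 0)

/-- A square-integrable vector field which is free of curl and divergence vanishes. -/
theorem eq_zero_of_curl_div {n : ℕ} (hn : 0 < n) {r : ℝ} (h : 1 ≤ r) (v : VSob n r)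
    (hcurl : ∀ j k, pderiv j (v k).toL2 = pderiv k (v j).toL2) (hdiv : divergence v.toL2 = 0) :
    v.toL2 = 0 := by
  have h1 : ∀ᵐ ξ, ∀ j k, dsymb j ξ * fhat (v k).toL2 ξ = dsymb k ξ * fhat (v j).toL2 ξ := by
    refine ae_all_iff.mpr fun j => ae_all_iff.mpr fun k => ?_
    have hj := fhat_pderiv j h (v k)
    rw [hcurl j k] at hj
    filter_upwards [hj, fhat_pderiv k h (v j)] with ξ a b
    rw [← a, b]
  have h2 := fhat_divergence h v
  rw [hdiv, map_zero] at h2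
  funext k
  apply ext_fhat
  change fhat (v k).toL2 =ᵐ[volume] fhat (0 : L2R n)
  rw [map_zero]
  filter_upwards [h1, h2, Lp.coeFn_zero ℂ 2 (volume : Measure (Rn n)), ae_ne_zero hn]
    with ξ a b c hξ
  rw [c] at b ⊢
  have h3 : (∑ j, dsymb j ξ * dsymb j ξ) * fhat (v k).toL2 ξ = 0 := by
    calc _ = ∑ j, dsymb k ξ * (dsymb j ξ * fhat (v j).toL2 ξ) := by
          rw [Finset.sum_mul]
          refine Finset.sum_congr rfl fun j _ => ?_
          rw [mul_assoc, a j k]; ring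
      _ = 0 := by rw [← Finset.mul_sum, ← b]; simp
  rw [sum_dsymb_sq] at h3
  rcases mul_eq_zero.mp h3 with h4 | h4
  · exfalso
    have : ‖(2 * Real.pi) • ξ‖ ^ 2 = 0 := by exact_mod_cast neg_eq_zero.mp h4
    have h5 : (2 * Real.pi) • ξ = 0 := by simpa using this
    rcases smul_eq_zero.mp h5 with h6 | h6
    · linarith [Real.pi_pos]
    · exact hξ h6
  · simpa using h4

/-- A weak gradient in `H^r`, `r ≥ 1`, is free of curl. -/
theorem HasWeakGrad.curl_eq_zero {n : ℕ} {r : ℝ} (h : 1 ≤ r) {q : Rn n → ℝ} {G : VSob n r}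
    (hq : HasWeakGrad q G.toL2) (j k : Fin n) :
    pderiv j (G k).toL2 = pderiv k (G j).toL2 := by
  apply Lp.ext
  refine ae_eq_of_integral_contDiff_smul_eq ((Lp.memLp _).locallyIntegrable one_le_two)
    ((Lp.memLp _).locallyIntegrable one_le_two) fun φ hφ hc => ?_
  have hd : ∀ i : Fin n, ContDiff ℝ ∞ fun x => fderiv ℝ φ x (stdVec i) := fun i =>
    (hφ.fderiv_right (m := ∞) le_rfl).clm_apply contDiff_const
  have hdc : ∀ i : Fin n, HasCompactSupport fun x => fderiv ℝ φ x (stdVec i) := fun i =>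
    hc.fderiv_apply ℝ _
  have h2 : ∀ i l : Fin n, ∀ x, fderiv ℝ (fun y => fderiv ℝ φ y (stdVec i)) x (stdVec l) =
      fderiv ℝ (fderiv ℝ φ) x (stdVec l) (stdVec i) := by
    intro i l x
    have hdiff : DifferentiableAt ℝ (fderiv ℝ φ) x :=
      ((hφ.fderiv_right (m := ∞) le_rfl).differentiable (by simp)) x
    rw [fderiv_clm_apply hdiff (differentiableAt_const _)]
    simp
  have key : ∀ i l : Fin n, ∫ x, pderiv i (G l).toL2 x * φ x =
      ∫ x, q x * fderiv ℝ (fderiv ℝ φ) x (stdVec l) (stdVec i) := by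
    intro i l
    have a := integral_mul_fderiv i h (G l) hφ hc
    have b := hq.2 _ (hd i) (hdc i) l
    have c : ∫ x, (G.toL2 l) x * fderiv ℝ φ x (stdVec i) =
        ∫ x, (G l).toL2 x * fderiv ℝ φ x (stdVec i) := rfl
    rw [c] at b
    simp only [h2] at b
    linarith
  have hsymm : ∀ x, fderiv ℝ (fderiv ℝ φ) x (stdVec k) (stdVec j) =
      fderiv ℝ (fderiv ℝ φ) x (stdVec j) (stdVec k) := by
    intro x
    exact (hφ.contDiffAt.isSymmSndFDerivAt (by
      rw [minSmoothness_of_isRCLikeNormedField]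
      exact WithTop.coe_le_coe.mpr (le_top : (2 : ℕ∞) ≤ ⊤))).eq _ _
  have e1 := key j k
  have e2 := key k j
  simp only [hsymm] at e1
  simp only [smul_eq_mul, mul_comm (φ _)]
  rw [e1, e2]

/-! ### The terms of the equations as Sobolev fields -/

section Terms

variable {n : ℕ} {s : ℝ}

theorem half_lt_sub_one (hs : (n : ℝ) / 2 + 1 < s) : (n : ℝ) / 2 < s - 1 := by linarith

theorem sub_one_nonneg (hs : (n : ℝ) / 2 + 1 < s) : 0 ≤ s - 1 :=
  le_trans (by positivity) (half_lt_sub_one hs).le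

theorem one_le_sub_one (hn : 2 ≤ n) (hs : (n : ℝ) / 2 + 1 < s) : 1 ≤ s - 1 := by
  have : (2 : ℝ) ≤ n := by exact_mod_cast hn
  linarith

/-- The inclusion `H^s → H^(s-1)`. -/
def lower (hs : (n : ℝ) / 2 + 1 < s) : Sob n s →L[ℝ] Sob n (s - 1) :=
  incl (sub_one_nonneg hs) (by linarith)

@[simp] theorem toL2_lower (hs : (n : ℝ) / 2 + 1 < s) (f : Sob n s) :
    (lower hs f).toL2 = f.toL2 := toL2_incl _ _ f

/-- The derivative `∂ₖ : H^s → H^(s-1)`. -/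
def dS (hs : (n : ℝ) / 2 + 1 < s) (k : Fin n) : Sob n s →L[ℝ] Sob n (s - 1) :=
  D k (sub_one_nonneg hs) (by linarith)

@[simp] theorem toL2_dS (hs : (n : ℝ) / 2 + 1 < s) (k : Fin n) (f : Sob n s) :
    (dS hs k f).toL2 = pderiv k f.toL2 := toL2_D k _ _ f

/-- `(u · ∇) u` as an element of `H^(s-1)`. -/
def advS (hs : (n : ℝ) / 2 + 1 < s) (u : VSob n s) : VSob n (s - 1) :=
  fun i => ∑ k, mulS (half_lt_sub_one hs) (lower hs (u k)) (dS hs k (u i))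

theorem toL2_advS (hs : (n : ℝ) / 2 + 1 < s) (u : VSob n s) :
    (advS hs u).toL2 = advect u.toL2 u.toL2 := by
  funext i
  simp [VSob.toL2, advS, advect]

theorem continuous_advS (hs : (n : ℝ) / 2 + 1 < s) : Continuous (advS hs) := by
  refine continuous_pi fun i => continuous_finsetSum _ fun k _ => ?_
  exact (mulS (half_lt_sub_one hs)).continuous₂.comp
    (((lower hs).continuous.comp (continuous_apply k)).prodMk
      ((dS hs k).continuous.comp (continuous_apply i)))

/-- `div u` as an element of `H^(s-1)`. -/
def divS (hs : (n : ℝ) / 2 + 1 < s) : VSob n s →L[ℝ] Sob n (s - 1) :=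
  ∑ k, (dS hs k).comp (ContinuousLinearMap.proj k)

theorem toL2_divS (hs : (n : ℝ) / 2 + 1 < s) (u : VSob n s) :
    (divS hs u).toL2 = divergence u.toL2 := by
  simp [divS, divergence, VSob.toL2]

/-- `∑ⱼₖ ∂ⱼ uₖ ∂ₖ uⱼ` as an element of `H^(s-1)`. -/
def sourceS (hs : (n : ℝ) / 2 + 1 < s) (u : VSob n s) : Sob n (s - 1) :=
  ∑ j, ∑ k, mulS (half_lt_sub_one hs) (dS hs j (u k)) (dS hs k (u j))

/-- `B(u, u)` as an element of `H^(s+1)`. -/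
def BS (hs : (n : ℝ) / 2 + 1 < s) (u : VSob n s) : Sob n (s + 1) :=
  highL (by linarith [sub_one_nonneg hs]) (by linarith) (sourceS hs u) +
    ∑ j, ∑ k, lowL j k (by linarith [sub_one_nonneg hs])
      (mulS (half_lt_sub_one hs) (lower hs (u j)) (lower hs (u k)))

theorem toL2_sourceS (hs : (n : ℝ) / 2 + 1 < s) (u : VSob n s) :
    (sourceS hs u).toL2 = ∑ j, ∑ k, mulL2 (pderiv j (u k).toL2) (pderiv k (u j).toL2) := by
  simp [sourceS]

theorem toL2_BS (hs : (n : ℝ) / 2 + 1 < s) (u : VSob n s) :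
    (BS hs u).toL2 = B u.toL2 u.toL2 := by
  rw [BS, map_add, toL2_highL, toL2_sourceS]
  simp [B, B₁, B₂, VSob.toL2]

theorem continuous_BS (hs : (n : ℝ) / 2 + 1 < s) : Continuous (BS hs : VSob n s → _) := by
  have cm := (mulS (half_lt_sub_one hs)).continuous₂
  refine Continuous.add ((highL _ _).continuous.comp ?_) ?_
  · refine continuous_finsetSum _ fun j _ => continuous_finsetSum _ fun k _ => ?_
    exact cm.comp (((dS hs j).continuous.comp (continuous_apply k)).prodMk
      ((dS hs k).continuous.comp (continuous_apply j)))
  · refine continuous_finsetSum _ fun j _ => continuous_finsetSum _ fun k _ => ?_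
    exact (lowL j k _).continuous.comp
      (cm.comp (((lower hs).continuous.comp (continuous_apply j)).prodMk
        ((lower hs).continuous.comp (continuous_apply k))))

/-- `∇B(u, u)` as an element of `H^s`. -/
def gradBS (hs : (n : ℝ) / 2 + 1 < s) (u : VSob n s) : VSob n s :=
  fun k => D k (by linarith [sub_one_nonneg hs]) le_rfl (BS hs u)

theorem toL2_gradBS (hs : (n : ℝ) / 2 + 1 < s) (u : VSob n s) :
    (gradBS hs u).toL2 = grad (B u.toL2 u.toL2) := by
  funext k
  simp [VSob.toL2, gradBS, grad, toL2_BS]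

theorem continuous_gradBS (hs : (n : ℝ) / 2 + 1 < s) : Continuous (gradBS hs : VSob n s → _) :=
  continuous_pi fun k => (D k _ _).continuous.comp (continuous_BS hs)

/-! ### The divergence of the equation -/

/-- `u · ∇ div u`. -/
def transport (u : VSob n s) : L2R n :=
  ∑ k, mulL2 (u k).toL2 (pderiv k (divergence u.toL2))

/-- `div (u div u)`. -/
def divFlux (u : VSob n s) : L2R n :=
  ∑ k, pderiv k (mulL2 (u k).toL2 (divergence u.toL2))

/-- `div ((u · ∇) u) = ∑ⱼₖ ∂ⱼ uₖ ∂ₖ uⱼ + u · ∇ div u`. -/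
theorem divergence_advect (hn : 2 ≤ n) (hs : (n : ℝ) / 2 + 1 < s) (u : VSob n s) :
    divergence (advect u.toL2 u.toL2) = (sourceS hs u).toL2 + transport u := by
  have h1 := one_le_sub_one hn hs
  have hh := half_lt_sub_one hs
  have e1 : ∀ i, pderiv i (advect u.toL2 u.toL2 i) =
      ∑ k, (mulL2 (pderiv i (u k).toL2) (pderiv k (u i).toL2) +
        mulL2 (u k).toL2 (pderiv k (pderiv i (u i).toL2))) := by
    intro i
    have := pderiv_sum i h1 Finset.univ fun k =>
      mulS hh (lower hs (u k)) (dS hs k (u i))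
    simp only [toL2_mulS] at this
    have h2 : advect u.toL2 u.toL2 i =
        ∑ k, mulL2 (lower hs (u k)).toL2 (dS hs k (u i)).toL2 := by
      simp [advect, VSob.toL2]
    rw [h2, this]
    refine Finset.sum_congr rfl fun k _ => ?_
    rw [pderiv_mulL2 i hh h1]
    simp only [toL2_lower, toL2_dS]
    rw [pderiv_comm i k (by linarith)]
  have e2 : ∀ k, ∑ i, mulL2 (u k).toL2 (pderiv k (pderiv i (u i).toL2)) =
      mulL2 (u k).toL2 (pderiv k (divergence u.toL2)) := by
    intro k
    rw [← toL2_lower hs (u k), ← mulL2_sum hh]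
    congr 1
    have := pderiv_sum k h1 Finset.univ fun i => dS hs i (u i)
    simp only [toL2_dS] at this
    rw [← this]
    rfl
  rw [divergence, Finset.sum_congr rfl fun i _ => e1 i]
  simp only [Finset.sum_add_distrib]
  rw [toL2_sourceS, transport]
  congr 1
  rw [Finset.sum_comm]
  exact Finset.sum_congr rfl fun k _ => e2 k

/-- `∑ₖ ∂ₖ (uⱼ uₖ) = (u · ∇) uⱼ + uⱼ div u`. -/
theorem sum_pderiv_mul (hn : 2 ≤ n) (hs : (n : ℝ) / 2 + 1 < s) (u : VSob n s) (j : Fin n) :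
    ∑ k, pderiv k (mulL2 (u j).toL2 (u k).toL2) =
      advect u.toL2 u.toL2 j + mulL2 (u j).toL2 (divergence u.toL2) := by
  have h1 := one_le_sub_one hn hs
  have hh := half_lt_sub_one hs
  have e : ∀ k, pderiv k (mulL2 (u j).toL2 (u k).toL2) =
      mulL2 (u k).toL2 (pderiv k (u j).toL2) + mulL2 (u j).toL2 (pderiv k (u k).toL2) := by
    intro k
    have := pderiv_mulL2 k hh h1 (lower hs (u j)) (lower hs (u k))
    simp only [toL2_lower] at this
    rw [this, mulL2_comm (pderiv k _)]
  rw [Finset.sum_congr rfl fun k _ => e k, Finset.sum_add_distrib]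
  congr 1
  rw [← toL2_lower hs (u j), ← mulL2_sum hh]
  rfl

/-- `div (u div u) = u · ∇ div u + (div u)²`. -/
theorem divFlux_eq (hn : 2 ≤ n) (hs : (n : ℝ) / 2 + 1 < s) (u : VSob n s) :
    divFlux u = transport u + mulL2 (divergence u.toL2) (divergence u.toL2) := by
  have h1 := one_le_sub_one hn hs
  have hh := half_lt_sub_one hs
  have e : ∀ k, pderiv k (mulL2 (u k).toL2 (divergence u.toL2)) =
      mulL2 (u k).toL2 (pderiv k (divergence u.toL2)) +
      mulL2 (divergence u.toL2) (pderiv k (u k).toL2) := by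
    intro k
    have := pderiv_mulL2 k hh h1 (lower hs (u k)) (divS hs u)
    simp only [toL2_lower, toL2_divS] at this
    rw [this, mulL2_comm (pderiv k _), add_comm]
  rw [divFlux, Finset.sum_congr rfl fun k _ => e k, Finset.sum_add_distrib, transport]
  congr 1
  rw [← toL2_divS hs, ← mulL2_sum hh, toL2_divS]
  rfl

theorem fhat_divFlux (hn : 2 ≤ n) (hs : (n : ℝ) / 2 + 1 < s) (u : VSob n s) :
    fhat (divFlux u) =ᵐ[volume] fun ξ =>
      ∑ j, dsymb j ξ * fhat (mulL2 (u j).toL2 (divergence u.toL2)) ξ := by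
  let w : VSob n (s - 1) := fun j => mulS (half_lt_sub_one hs) (lower hs (u j)) (divS hs u)
  have hw : ∀ j, (w j).toL2 = mulL2 (u j).toL2 (divergence u.toL2) := fun j => by
    rw [toL2_mulS, toL2_lower, toL2_divS]
  have e : divFlux u = divergence w.toL2 :=
    Finset.sum_congr rfl fun k _ => by rw [← hw]; rfl
  rw [e]
  filter_upwards [fhat_divergence (one_le_sub_one hn hs) w] with ξ hξ
  rw [hξ]
  simp only [hw]

theorem neg_norm_sq_mul_highSymb {η : Rn n} (h : η ≠ 0) :
    -‖η‖ ^ 2 * highSymb η = 1 - cutoff η := by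
  have : -‖η‖ ^ 2 ≠ 0 := by simpa using h
  rw [highSymb, ← mul_assoc, mul_inv_cancel₀ this, one_mul]

theorem neg_norm_sq_mul_lowSymb {η : Rn n} (h : η ≠ 0) (j k : Fin n) :
    -‖η‖ ^ 2 * lowSymb j k η = cutoff η * (-(η j * η k)) := by
  have : -‖η‖ ^ 2 ≠ 0 := by simpa using h
  rw [lowSymb, ← mul_assoc, ← mul_assoc, mul_inv_cancel₀ this, one_mul]

/-- `B` is built so that `Δ B(u, u)` equals `∑ⱼₖ ∂ⱼ uₖ ∂ₖ uⱼ` up to a low-frequency term which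
vanishes together with `div u`. -/
theorem fhat_divergence_grad_B (hn : 2 ≤ n) (hs : (n : ℝ) / 2 + 1 < s) (u : VSob n s) :
    fhat (divergence (grad (B u.toL2 u.toL2))) =ᵐ[volume] fun ξ =>
      fhat (sourceS hs u).toL2 ξ +
        (cutoff ((2 * Real.pi) • ξ) : ℂ) * fhat (transport u + divFlux u) ξ := by
  have h1 := one_le_sub_one hn hs
  have hh := half_lt_sub_one hs
  -- the Fourier transform of `B`
  have hB : fhat (BS hs u).toL2 =ᵐ[volume] fun ξ =>
      (highSymb ((2 * Real.pi) • ξ) : ℂ) * fhat (sourceS hs u).toL2 ξ +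
      ∑ j, ∑ k, (lowSymb j k ((2 * Real.pi) • ξ) : ℂ) *
        fhat (mulL2 (u j).toL2 (u k).toL2) ξ := by
    have e : (BS hs u).toL2 = invLaplaceHigh (sourceS hs u).toL2 +
        ∑ j, ∑ k, invLaplaceLow j k (mulL2 (u j).toL2 (u k).toL2) := by
      simp [BS]
    have hl : ∀ᵐ ξ, ∀ j k, fhat (invLaplaceLow j k (mulL2 (u j).toL2 (u k).toL2)) ξ =
        (lowSymb j k ((2 * Real.pi) • ξ) : ℂ) * fhat (mulL2 (u j).toL2 (u k).toL2) ξ :=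
      ae_all_iff.mpr fun j => ae_all_iff.mpr fun k => fhat_invLaplaceLow j k _
    have hsum : ∀ᵐ ξ, ∀ j, fhat (∑ k, invLaplaceLow j k (mulL2 (u j).toL2 (u k).toL2)) ξ =
        ∑ k, fhat (invLaplaceLow j k (mulL2 (u j).toL2 (u k).toL2)) ξ :=
      ae_all_iff.mpr fun j => fhat_sum_ae _ _
    rw [e]
    filter_upwards [fhat_add_ae (invLaplaceHigh (sourceS hs u).toL2)
        (∑ j, ∑ k, invLaplaceLow j k (mulL2 (u j).toL2 (u k).toL2)),
      fhat_invLaplaceHigh (sourceS hs u).toL2, hl, hsum,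
      fhat_sum_ae Finset.univ fun j => ∑ k, invLaplaceLow j k (mulL2 (u j).toL2 (u k).toL2)]
      with ξ a b c d f
    rw [a, b, f]
    congr 1
    refine Finset.sum_congr rfl fun j _ => ?_
    rw [d]
    exact Finset.sum_congr rfl fun k _ => c j k
  -- the Fourier transform of `∑ⱼₖ ∂ⱼ ∂ₖ (uⱼ uₖ)`
  have hW : ∀ᵐ ξ, ∑ j, ∑ k, dsymb j ξ * dsymb k ξ * fhat (mulL2 (u j).toL2 (u k).toL2) ξ =
      fhat (divergence (advect u.toL2 u.toL2) + divFlux u) ξ := by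
    have a1 : ∀ᵐ ξ, ∀ j k, fhat (pderiv k (mulL2 (u j).toL2 (u k).toL2)) ξ =
        dsymb k ξ * fhat (mulL2 (u j).toL2 (u k).toL2) ξ := by
      refine ae_all_iff.mpr fun j => ae_all_iff.mpr fun k => ?_
      have := fhat_pderiv k h1 (mulS hh (lower hs (u j)) (lower hs (u k)))
      simp only [toL2_mulS, toL2_lower] at this
      exact this
    have a2 : ∀ᵐ ξ, ∀ j, ∑ k, fhat (pderiv k (mulL2 (u j).toL2 (u k).toL2)) ξ =
        fhat (advect u.toL2 u.toL2 j) ξ + fhat (mulL2 (u j).toL2 (divergence u.toL2)) ξ := by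
      refine ae_all_iff.mpr fun j => ?_
      have := fhat_sum_ae Finset.univ fun k => pderiv k (mulL2 (u j).toL2 (u k).toL2)
      rw [sum_pderiv_mul hn hs] at this
      filter_upwards [this, fhat_add_ae (advect u.toL2 u.toL2 j)
        (mulL2 (u j).toL2 (divergence u.toL2))] with ξ a b
      rw [← a, b]
    have a3 := fhat_divergence h1 (advS hs u)
    rw [toL2_advS] at a3
    have a4 : ∀ᵐ ξ, ∀ j, fhat (advS hs u j).toL2 ξ = fhat (advect u.toL2 u.toL2 j) ξ := by
      refine Eventually.of_forall fun ξ j => ?_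
      rw [← toL2_advS hs]; rfl
    have a5 := fhat_divFlux hn hs u
    filter_upwards [a1, a2, a3, a4, a5, fhat_add_ae (divergence (advect u.toL2 u.toL2))
      (divFlux u)] with ξ b1 b2 b3 b4 b5 b6
    rw [b6, b3, b5, ← Finset.sum_add_distrib]
    refine Finset.sum_congr rfl fun j _ => ?_
    rw [b4, ← mul_add, ← b2, Finset.mul_sum]
    refine Finset.sum_congr rfl fun k _ => ?_
    rw [b1, mul_assoc]
  have hD : ∀ᵐ ξ, ∀ k, fhat (gradBS hs u k).toL2 ξ = dsymb k ξ * fhat (BS hs u).toL2 ξ := by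
    refine ae_all_iff.mpr fun k => ?_
    rw [gradBS, toL2_D]
    exact fhat_pderiv k (by linarith) (BS hs u)
  have hdiv := fhat_divergence (by linarith : 1 ≤ s) (gradBS hs u)
  rw [toL2_gradBS] at hdiv
  rw [divergence_advect hn hs] at hW
  filter_upwards [hdiv, hD, hB, hW, ae_ne_zero (by omega : 0 < n),
    fhat_add_ae ((sourceS hs u).toL2 + transport u) (divFlux u),
    fhat_add_ae (sourceS hs u).toL2 (transport u),
    fhat_add_ae (transport u) (divFlux u)] with ξ d1 d2 d3 d4 hξ d5 d6 d7
  have hη : (2 * Real.pi) • ξ ≠ 0 := smul_ne_zero (by positivity) hξ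
  rw [d5, d6] at d4
  rw [d1, d7]
  set η := (2 * Real.pi) • ξ with hηdef
  have hcomp : ∀ j, η j = 2 * Real.pi * ξ j := fun j => by simp [hηdef]
  have s1 : ∑ k, dsymb k ξ * fhat (gradBS hs u k).toL2 ξ =
      ((-‖η‖ ^ 2 : ℝ) : ℂ) * fhat (BS hs u).toL2 ξ := by
    rw [Complex.ofReal_neg, ← sum_dsymb_sq, Finset.sum_mul]
    refine Finset.sum_congr rfl fun k _ => ?_
    rw [d2, mul_assoc]
  have s2 : ∀ j k, ((-‖η‖ ^ 2 : ℝ) : ℂ) * (lowSymb j k η : ℂ) =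
      (cutoff η : ℂ) * (dsymb j ξ * dsymb k ξ) := by
    intro j k
    rw [← Complex.ofReal_mul, neg_norm_sq_mul_lowSymb hη, hcomp, hcomp, dsymb, dsymb]
    push_cast
    linear_combination -(cutoff η : ℂ) * (2 * Real.pi * (ξ j : ℂ)) * (2 * Real.pi * (ξ k : ℂ)) *
      Complex.I_mul_I
  have s3 : ((-‖η‖ ^ 2 : ℝ) : ℂ) * ∑ j, ∑ k, (lowSymb j k η : ℂ) *
      fhat (mulL2 (u j).toL2 (u k).toL2) ξ = (cutoff η : ℂ) *
      ∑ j, ∑ k, dsymb j ξ * dsymb k ξ * fhat (mulL2 (u j).toL2 (u k).toL2) ξ := by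
    simp only [Finset.mul_sum]
    refine Finset.sum_congr rfl fun j _ => Finset.sum_congr rfl fun k _ => ?_
    rw [← mul_assoc, s2]; ring
  have s4 : ((-‖η‖ ^ 2 : ℝ) : ℂ) * (highSymb η : ℂ) = 1 - (cutoff η : ℂ) := by
    rw [← Complex.ofReal_mul, neg_norm_sq_mul_highSymb hη]; push_cast; ring
  rw [s1, d3, mul_add, s3, d4, ← mul_assoc, s4]
  ring

/-! ### The energy estimate for the divergence -/

/-- `⟨u · ∇ d, d⟩ = -½ ⟨d, d²⟩` for `d = div u`. -/
theorem two_mul_inner_transport (hn : 2 ≤ n) (hs : (n : ℝ) / 2 + 1 < s) (u : VSob n s) :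
    2 * inner ℝ (transport u) (divergence u.toL2) =
      -inner ℝ (divergence u.toL2) (mulL2 (divergence u.toL2) (divergence u.toL2)) := by
  have h1 := one_le_sub_one hn hs
  have hh := half_lt_sub_one hs
  have e : inner ℝ (transport u) (divergence u.toL2) =
      -inner ℝ (divergence u.toL2) (divFlux u) := by
    rw [transport, divFlux, sum_inner, inner_sum, ← Finset.sum_neg_distrib]
    refine Finset.sum_congr rfl fun k _ => ?_
    have a := inner_mulL2 hh (lower hs (u k)) (pderiv k (divergence u.toL2)) (divergence u.toL2)
    have b := inner_pderiv k h1 (divS hs u) (mulS hh (lower hs (u k)) (divS hs u))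
    simp only [toL2_lower, toL2_mulS, toL2_divS] at a b
    rw [a, b]
  rw [divFlux_eq hn hs, inner_add_right, real_inner_comm (transport u)] at e
  linarith

theorem norm_cutoff_le (η : Rn n) : ‖((cutoff η : ℝ) : ℂ)‖ ≤ 1 := by
  rw [Complex.norm_real, cutoff_eq]
  split_ifs <;> simp

theorem norm_cutoff_mul_dsymb_le (k : Fin n) (ξ : Rn n) :
    ‖(cutoff ((2 * Real.pi) • ξ) : ℂ) * dsymb k ξ‖ ≤ 1 := by
  rw [norm_mul, Complex.norm_real, cutoff_eq]
  split_ifs with h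
  · have := norm_dsymb_le k ξ
    rw [norm_smul, Real.norm_of_nonneg (by positivity)] at h
    simp; linarith
  · simp

/-- The `L²` norm of the divergence obeys a linear differential inequality: the transport term is
skew-symmetric up to `div u`, and on low frequencies a derivative is bounded. -/
theorem exists_energy_bound (hn : 2 ≤ n) (hs : (n : ℝ) / 2 + 1 < s) :
    ∃ C : ℝ, 0 ≤ C ∧ ∀ u : VSob n s,
      |inner ℝ (divergence u.toL2)
        (divergence (grad (B u.toL2 u.toL2)) - divergence (advect u.toL2 u.toL2))| ≤
        C * ‖u‖ * ‖divergence u.toL2‖ ^ 2 := by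
  have h1 := one_le_sub_one hn hs
  have hh := half_lt_sub_one hs
  set M := ‖mulLow (n := n) hh‖ with hM
  set a := ‖lower (n := n) hs‖ with ha
  set b := ‖divS (n := n) hs‖ with hb
  refine ⟨2 * (n * (M * a)) + 2 * (M * b), by positivity, fun u => ?_⟩
  set d := divergence u.toL2 with hd
  have hud : ∀ k, ‖mulL2 (u k).toL2 d‖ ≤ M * a * ‖u‖ * ‖d‖ := by
    intro k
    rw [← toL2_lower hs, ← mulLow_apply hh]
    calc _ ≤ M * ‖lower hs (u k)‖ * ‖d‖ := (mulLow hh).le_opNorm₂ _ _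
      _ ≤ M * (a * ‖u‖) * ‖d‖ := by
        gcongr
        refine ((lower hs).le_opNorm _).trans ?_
        gcongr
        exact norm_le_pi_norm u k
      _ = _ := by ring
  have hdd : ‖mulL2 d d‖ ≤ M * b * ‖u‖ * ‖d‖ := by
    have : mulL2 d d = mulLow hh (divS hs u) d := by rw [mulLow_apply, toL2_divS]
    rw [this]
    calc _ ≤ M * ‖divS hs u‖ * ‖d‖ := (mulLow hh).le_opNorm₂ _ _
      _ ≤ M * (b * ‖u‖) * ‖d‖ := by
        gcongr
        exact (divS hs).le_opNorm _
      _ = _ := by ring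
  have mc : Measurable fun ξ : Rn n => (cutoff ((2 * Real.pi) • ξ) : ℂ) :=
    Complex.measurable_ofReal.comp (measurable_cutoff.comp (by fun_prop))
  have Hc : Hermitian fun ξ : Rn n => (cutoff ((2 * Real.pi) • ξ) : ℂ) :=
    hermitian_ofReal fun ξ => by rw [smul_neg, cutoff_neg]
  -- the low-frequency parts of `div (u d)` and of `d²`
  have exk : ∀ k, ∃ g : L2R n, _ := fun k => exists_multiplier_L2 (mc.mul (measurable_dsymb k))
    (Hc.mul (hermitian_dsymb k)) (norm_cutoff_mul_dsymb_le k) (mulL2 (u k).toL2 d)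
  choose g hg hgn using exk
  obtain ⟨q, hq, hqn⟩ := exists_multiplier_L2 mc Hc (fun ξ => norm_cutoff_le _) (mulL2 d d)
  have hflux := fhat_divFlux hn hs u
  have heq : divergence (grad (B u.toL2 u.toL2)) - divergence (advect u.toL2 u.toL2) =
      ((2 : ℝ) • ∑ k, g k - q) - transport u := by
    rw [sub_eq_sub_iff_add_eq_add, divergence_advect hn hs]
    apply ext_fhat
    have hg' : ∀ᵐ ξ, ∀ k, fhat (g k) ξ = _ := ae_all_iff.mpr hg
    have e2 := divFlux_eq hn hs u
    have e3 : transport u = divFlux u - mulL2 d d := by rw [e2]; abel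
    filter_upwards [fhat_divergence_grad_B hn hs u, hg', hq, hflux,
      fhat_add_ae (divergence (grad (B u.toL2 u.toL2))) (transport u),
      fhat_add_ae ((2 : ℝ) • ∑ k, g k - q) ((sourceS hs u).toL2 + transport u),
      fhat_sub_ae ((2 : ℝ) • ∑ k, g k) q, fhat_smul_ae 2 (∑ k, g k),
      fhat_sum_ae Finset.univ g, fhat_add_ae (sourceS hs u).toL2 (transport u),
      fhat_add_ae (transport u) (divFlux u), fhat_sub_ae (divFlux u) (mulL2 d d)]
      with ξ c1 c2 c3 c4 c5 c6 c7 c8 c9 c10 c11 c12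
    have c13 : fhat (transport u) ξ = fhat (divFlux u) ξ - fhat (mulL2 d d) ξ := by
      rw [← c12, e3]
    have c14 : ∑ k, fhat (g k) ξ =
        (cutoff ((2 * Real.pi) • ξ) : ℂ) * fhat (divFlux u) ξ := by
      rw [c4, Finset.mul_sum]
      refine Finset.sum_congr rfl fun k _ => ?_
      rw [c2, Pi.mul_apply]; ring
    rw [c5, c6, c1, c7, c8, c9, c10, c11, c14, c3, c13]
    push_cast
    ring
  have ht := two_mul_inner_transport hn hs u
  rw [← hd] at ht
  rw [heq, inner_sub_right]
  have n1 : ‖(2 : ℝ) • ∑ k, g k - q‖ ≤ (2 * (n * (M * a)) + M * b) * ‖u‖ * ‖d‖ := by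
    have : ‖∑ k, g k‖ ≤ n * (M * a * ‖u‖ * ‖d‖) := by
      refine (norm_sum_le_of_le _ fun k _ =>
        ((hgn k).trans (by rw [one_mul])).trans (hud k)).trans ?_
      simp
    calc _ ≤ ‖(2 : ℝ) • ∑ k, g k‖ + ‖q‖ := norm_sub_le _ _
      _ ≤ 2 * (n * (M * a * ‖u‖ * ‖d‖)) + M * b * ‖u‖ * ‖d‖ := by
        rw [norm_smul]
        gcongr
        · simp
        · exact hqn.trans (by rw [one_mul]; exact hdd)
      _ = _ := by ring
  have n2 : |inner ℝ d (mulL2 d d)| ≤ M * b * ‖u‖ * ‖d‖ ^ 2 := by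
    refine (abs_real_inner_le_norm _ _).trans ?_
    calc _ ≤ ‖d‖ * (M * b * ‖u‖ * ‖d‖) := by gcongr
      _ = _ := by ring
  have n3 : |inner ℝ d ((2 : ℝ) • ∑ k, g k - q)| ≤
      (2 * (n * (M * a)) + M * b) * ‖u‖ * ‖d‖ ^ 2 := by
    refine (abs_real_inner_le_norm _ _).trans ?_
    calc _ ≤ ‖d‖ * ((2 * (n * (M * a)) + M * b) * ‖u‖ * ‖d‖) := by gcongr
      _ = _ := by ring
  have n4 : |inner ℝ d (transport u)| ≤ M * b * ‖u‖ * ‖d‖ ^ 2 := by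
    rw [real_inner_comm]
    have : |2 * inner ℝ (transport u) d| ≤ M * b * ‖u‖ * ‖d‖ ^ 2 := by rw [ht, abs_neg]; exact n2
    rw [abs_mul, abs_two] at this
    linarith [abs_nonneg (inner ℝ (transport u) d)]
  calc _ ≤ |inner ℝ d ((2 : ℝ) • ∑ k, g k - q)| + |inner ℝ d (transport u)| := abs_sub _ _
    _ ≤ _ := by linarith [n3, n4]

end Terms

/-! ### Evolution in time -/

theorem hasDerivWithinAt_integral_of_continuousOn {E : Type*} [NormedAddCommGroup E]
    [NormedSpace ℝ E] [CompleteSpace E] {T : ℝ} {Φ : ℝ → E} (hΦ : ContinuousOn Φ (Icc 0 T))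
    {t : ℝ} (ht : t ∈ Ico 0 T) :
    HasDerivWithinAt (fun x => ∫ τ in (0 : ℝ)..x, Φ τ) (Φ t) (Ici t) t := by
  have hT : (0 : ℝ) ≤ T := ht.1.trans ht.2.le
  set Ψ : ℝ → E := IccExtend hT (Set.domRestrict (Icc 0 T) Φ) with hΨ
  have hc : Continuous Ψ := hΦ.domRestrict.Icc_extend'
  have he : ∀ x ∈ Icc 0 T, Ψ x = Φ x := fun x hx => IccExtend_of_mem hT _ hx
  have hd : HasDerivWithinAt (fun x => ∫ τ in (0 : ℝ)..x, Ψ τ) (Ψ t) (Ici t) t :=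
    (hc.integral_hasStrictDerivAt 0 t).hasDerivAt.hasDerivWithinAt
  have hi : ∀ x ∈ Icc 0 T, ∫ τ in (0 : ℝ)..x, Φ τ = ∫ τ in (0 : ℝ)..x, Ψ τ := by
    intro x hx
    refine intervalIntegral.integral_congr fun τ hτ => (he τ ?_).symm
    rw [uIcc_of_le hx.1] at hτ
    exact ⟨hτ.1, hτ.2.trans hx.2⟩
  rw [← he t ⟨ht.1, ht.2.le⟩]
  refine hd.congr_of_eventuallyEq ?_ (hi t ⟨ht.1, ht.2.le⟩)
  filter_upwards [Icc_mem_nhdsGE ht.2] with x hx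
  exact hi x ⟨ht.1.trans hx.1, hx.2⟩

theorem VSob.toL2_add {n : ℕ} {r : ℝ} (v w : VSob n r) : (v + w).toL2 = v.toL2 + w.toL2 := by
  funext i; simp [VSob.toL2]

theorem VSob.toL2_sub {n : ℕ} {r : ℝ} (v w : VSob n r) : (v - w).toL2 = v.toL2 - w.toL2 := by
  funext i; simp [VSob.toL2]

theorem VSob.toL2_neg {n : ℕ} {r : ℝ} (v : VSob n r) : (-v).toL2 = -v.toL2 := by
  funext i; simp [VSob.toL2]

/-- The inclusion of vector fields `H^r → L²`. -/
def vtoL2L {n : ℕ} {r : ℝ} (h0 : 0 ≤ r) : VSob n r →L[ℝ] VL2 n :=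
  ContinuousLinearMap.pi fun i => (toL2L h0).comp (ContinuousLinearMap.proj i)

/-- The inclusion of vector fields `H^s → H^(s-1)`. -/
def vlower {n : ℕ} {s : ℝ} (hs : (n : ℝ) / 2 + 1 < s) : VSob n s →L[ℝ] VSob n (s - 1) :=
  ContinuousLinearMap.pi fun i => (lower hs).comp (ContinuousLinearMap.proj i)

theorem toL2_vlower {n : ℕ} {s : ℝ} (hs : (n : ℝ) / 2 + 1 < s) (v : VSob n s) :
    (vlower hs v).toL2 = v.toL2 := by
  funext i
  exact toL2_lower hs (v i)

/-- The divergence may be taken under the time integral when the integrand is continuous with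
values in `H^(s-1)`; the Bochner integral there is meaningful since that space is complete. -/
theorem divergence_eq_integral {n : ℕ} {s : ℝ} (hn : 2 ≤ n) (hs : (n : ℝ) / 2 + 1 < s)
    {v v₀ : VSob n s} {Ψ : ℝ → VSob n (s - 1)} {T t : ℝ} (hΨ : ContinuousOn Ψ (Icc 0 T))
    (ht : t ∈ Icc 0 T) (h : v.toL2 = v₀.toL2 + ∫ τ in (0 : ℝ)..t, (Ψ τ).toL2) :
    divergence v.toL2 = divergence v₀.toL2 + ∫ τ in (0 : ℝ)..t, divergence (Ψ τ).toL2 := by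
  have h1 := one_le_sub_one hn hs
  have h0 := sub_one_nonneg hs
  have : CompleteSpace (Sob n (s - 1)) := completeSpace_sob h0
  have hint : IntervalIntegrable Ψ volume 0 t := by
    apply ContinuousOn.intervalIntegrable
    rw [uIcc_of_le ht.1]
    exact hΨ.mono (Icc_subset_Icc_right ht.2)
  have e1 : (∫ τ in (0 : ℝ)..t, (Ψ τ).toL2) = (∫ τ in (0 : ℝ)..t, Ψ τ).toL2 :=
    (vtoL2L h0).intervalIntegral_comp_comm hint
  have e2 : (∫ τ in (0 : ℝ)..t, divL h1 (Ψ τ)) = divL h1 (∫ τ in (0 : ℝ)..t, Ψ τ) :=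
    (divL h1).intervalIntegral_comp_comm hint
  have e3 : v.toL2 = (vlower hs v₀ + ∫ τ in (0 : ℝ)..t, Ψ τ).toL2 := by
    rw [h, e1, VSob.toL2_add, toL2_vlower]
  simp only [← divL_apply h1]
  rw [e2, e3, ← divL_apply h1, map_add, divL_apply, divL_apply, toL2_vlower]

theorem continuousOn_divergence {n : ℕ} {s : ℝ} (hn : 2 ≤ n) (hs : (n : ℝ) / 2 + 1 < s) {T : ℝ}
    {Ψ : ℝ → VSob n (s - 1)} (hΨ : ContinuousOn Ψ (Icc 0 T)) :
    ContinuousOn (fun τ => divergence (Ψ τ).toL2) (Icc 0 T) := by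
  simp only [← divL_apply (one_le_sub_one hn hs)]
  exact (divL _).continuous.comp_continuousOn hΨ

/-- The pressure gradient of an Euler solution is `-∇B(u, u)`. -/
theorem pressure_gradient_eq {n : ℕ} {s : ℝ} (hn : 2 ≤ n) (hs : (n : ℝ) / 2 + 1 < s)
    {u G : VSob n s} {q : Rn n → ℝ} (hq : HasWeakGrad q G.toL2) (hu : divergence u.toL2 = 0)
    (hG : divergence (-advect u.toL2 u.toL2 - G.toL2) = 0) :
    G.toL2 = -grad (B u.toL2 u.toL2) := by
  have h1 := one_le_sub_one hn hs
  have hs1 : 1 ≤ s := by linarith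
  -- with `div u = 0` the low-frequency correction vanishes
  have ht : transport u = 0 := by
    refine Finset.sum_eq_zero fun k _ => ?_
    rw [hu, pderiv_zero, ← toL2_lower hs, mulL2_zero (half_lt_sub_one hs)]
  have hf : divFlux u = 0 := by
    refine Finset.sum_eq_zero fun k _ => ?_
    rw [hu, ← toL2_lower hs, mulL2_zero (half_lt_sub_one hs), pderiv_zero]
  have hB : divergence (grad (B u.toL2 u.toL2)) = divergence (advect u.toL2 u.toL2) := by
    rw [divergence_advect hn hs, ht, add_zero]
    apply ext_fhat
    have := fhat_divergence_grad_B hn hs u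
    rw [ht, hf, add_zero, map_zero] at this
    filter_upwards [this, Lp.coeFn_zero ℂ 2 (volume : Measure (Rn n))] with ξ a b
    rw [a, b]; simp
  have hsum : divergence (G + gradBS hs u).toL2 = 0 := by
    rw [← toL2_advS hs, ← toL2_vlower hs, ← VSob.toL2_neg, ← VSob.toL2_sub, ← divL_apply h1,
      map_sub, map_neg, divL_apply, divL_apply, toL2_vlower, toL2_advS, ← hB] at hG
    rw [← divL_apply hs1, map_add, divL_apply, divL_apply, toL2_gradBS]
    rw [← neg_eq_zero, ← hG]
    abel
  have hcurl : ∀ j k, pderiv j ((G + gradBS hs u) k).toL2 = pderiv k ((G + gradBS hs u) j).toL2 := by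
    intro j k
    have hk : ∀ i, ((G + gradBS hs u) i).toL2 = (G i).toL2 + (gradBS hs u i).toL2 := fun i => by
      simp
    rw [← dL_apply j hs1, ← dL_apply k hs1, Pi.add_apply, Pi.add_apply, map_add, map_add,
      dL_apply, dL_apply, dL_apply, dL_apply, hq.curl_eq_zero hs1 j k]
    congr 1
    rw [gradBS, gradBS, toL2_D, toL2_D]
    exact pderiv_comm j k (by linarith) (BS hs u)
  have := eq_zero_of_curl_div (by omega) hs1 _ hcurl hsum
  rw [VSob.toL2_add, toL2_gradBS] at this
  exact eq_neg_of_add_eq_zero_left this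

/-- A solution of the modified equation which is initially free of divergence stays so. -/
theorem divergence_eq_zero_of_modified {n : ℕ} {s : ℝ} (hn : 2 ≤ n) (hs : (n : ℝ) / 2 + 1 < s)
    {T : ℝ} {u₀ : VSob n s} {u : ℝ → VSob n s} (h₀ : divergence u₀.toL2 = 0)
    (hu : IsModifiedSolution T u₀ u) : ∀ t ∈ Icc 0 T, divergence (u t).toL2 = 0 := by
  obtain ⟨hc, heq⟩ := hu
  set Ψ : ℝ → VSob n (s - 1) := fun τ => vlower hs (gradBS hs (u τ)) - advS hs (u τ) with hΨ
  have hΨc : ContinuousOn Ψ (Icc 0 T) :=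
    ((vlower hs).continuous.comp_continuousOn ((continuous_gradBS hs).comp_continuousOn hc)).sub
      ((continuous_advS hs).comp_continuousOn hc)
  have hΨ2 : ∀ τ, (Ψ τ).toL2 = grad (B (u τ).toL2 (u τ).toL2) - advect (u τ).toL2 (u τ).toL2 := by
    intro τ
    rw [hΨ, VSob.toL2_sub, toL2_vlower, toL2_gradBS, toL2_advS]
  have hdΨ : ∀ τ, divergence (Ψ τ).toL2 = divergence (grad (B (u τ).toL2 (u τ).toL2)) -
      divergence (advect (u τ).toL2 (u τ).toL2) := by
    intro τ
    have h1 := one_le_sub_one hn hs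
    rw [← divL_apply h1, map_sub, divL_apply, divL_apply, toL2_vlower, toL2_gradBS, toL2_advS]
  set d : ℝ → L2R n := fun t => ∫ τ in (0 : ℝ)..t, divergence (Ψ τ).toL2 with hd
  have hdiv : ∀ t ∈ Icc 0 T, divergence (u t).toL2 = d t := by
    intro t ht
    have := divergence_eq_integral hn hs hΨc ht (by simpa only [hΨ2] using heq t ht)
    rw [this, h₀, zero_add]
  obtain ⟨C, hC, hbound⟩ := exists_energy_bound hn hs
  obtain ⟨R, hR⟩ := isCompact_Icc.exists_bound_of_continuousOn hc
  have hΦ := continuousOn_divergence hn hs hΨc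
  have hder : ∀ t ∈ Ico 0 T, HasDerivWithinAt d (divergence (Ψ t).toL2) (Ici t) t :=
    fun t ht => hasDerivWithinAt_integral_of_continuousOn hΦ ht
  have hdc : ContinuousOn d (Icc 0 T) := by
    have : ContinuousOn (fun t => divergence (u t).toL2) (Icc 0 T) := by
      simp only [← divL_apply (by linarith [one_le_sub_one hn hs] : 1 ≤ s)]
      exact (divL _).continuous.comp_continuousOn hc
    exact this.congr fun t ht => (hdiv t ht).symm
  have hz := eq_zero_of_abs_deriv_le_mul_abs_self_of_eq_zero_right
    (f := fun t => ‖d t‖ ^ 2) (f' := fun t => 2 * inner ℝ (d t) (divergence (Ψ t).toL2))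
    (K := 2 * (C * R)) (a := 0) (b := T) (hdc.norm.pow 2) (fun t ht => (hder t ht).norm_sq)
    (by simp [hd]) fun t ht => ?_
  · intro t ht
    rw [hdiv t ht]
    simpa using hz t ht
  · have ht' : t ∈ Icc 0 T := ⟨ht.1, ht.2.le⟩
    have hb := hbound (u t)
    rw [← hdΨ, hdiv t ht'] at hb
    rw [norm_mul, Real.norm_eq_abs, Real.norm_eq_abs, abs_two, Real.norm_eq_abs,
      abs_of_nonneg (by positivity : 0 ≤ ‖d t‖ ^ 2), mul_assoc]
    refine mul_le_mul_of_nonneg_left (hb.trans ?_) zero_le_two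
    have := hR t ht'
    gcongr

/-- `-∇B(u, u)` is the weak gradient of the function `-B(u, u)`. -/
theorem hasWeakGrad_neg_B {n : ℕ} {s : ℝ} (hs : (n : ℝ) / 2 + 1 < s) (u : VSob n s) :
    HasWeakGrad (fun x => -(B u.toL2 u.toL2 : L2R n) x) (-gradBS hs u).toL2 := by
  have hs1 : 1 ≤ s + 1 := by linarith [sub_one_nonneg hs]
  refine ⟨((Lp.memLp _).locallyIntegrable one_le_two).neg, fun φ hφ hφc k => ?_⟩
  have h := integral_mul_fderiv k hs1 (BS hs u) hφ hφc
  rw [toL2_BS] at h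
  have e : ∫ x, (-gradBS hs u).toL2 k x * φ x =
      -∫ x, pderiv k (B u.toL2 u.toL2) x * φ x := by
    rw [← integral_neg]
    apply integral_congr_ae
    rw [VSob.toL2_neg, toL2_gradBS]
    filter_upwards [Lp.coeFn_neg (pderiv k (B u.toL2 u.toL2))] with x hx
    change (-pderiv k (B u.toL2 u.toL2) : L2R n) x * φ x = _
    rw [hx, Pi.neg_apply, neg_mul]
  rw [e, ← h, ← integral_neg]
  simp only [neg_mul]

end EulerSobolev

end

theorem mainTheorem7 (n : ℕ) (hn : 2 ≤ n) (s : ℝ) (hs : (n : ℝ) / 2 + 1 < s)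
    (T : ℝ) (hT : 0 < T) (u₀ : EulerSobolev.VSob n s) (u : ℝ → EulerSobolev.VSob n s) :
    (∀ p : ℝ → EulerSobolev.Rn n → ℝ,
      EulerSobolev.IsEulerSolution T u₀ u p → EulerSobolev.IsModifiedSolution T u₀ u) ∧
    (EulerSobolev.divergence u₀.toL2 = 0 → EulerSobolev.IsModifiedSolution T u₀ u →
      EulerSobolev.IsEulerSolution T u₀ u
        (fun t x => -(EulerSobolev.B (u t).toL2 (u t).toL2 : EulerSobolev.L2R n) x)) := by
  open EulerSobolev in
  constructor
  · rintro p ⟨hc, G, hGc, hGw, heq, hdiv⟩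
    refine ⟨hc, ?_⟩
    let Ψ : ℝ → VSob n (s - 1) := fun τ => -advS hs (u τ) - vlower hs (G τ)
    have hΨc : ContinuousOn Ψ (Icc 0 T) :=
      ((continuous_advS hs).comp_continuousOn hc).neg.sub
        ((vlower hs).continuous.comp_continuousOn hGc)
    have hΨ2 : ∀ τ, (Ψ τ).toL2 = -advect (u τ).toL2 (u τ).toL2 - (G τ).toL2 := by
      intro τ
      rw [VSob.toL2_sub, VSob.toL2_neg, toL2_vlower, toL2_advS]
    have h0 : (0 : ℝ) ∈ Icc 0 T := ⟨le_rfl, hT.le⟩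
    have hu₀ : divergence u₀.toL2 = 0 := by
      have h1 := heq 0 h0
      rw [intervalIntegral.integral_same, add_zero] at h1
      rw [← h1]; exact hdiv 0 h0
    have hint : ∀ t ∈ Icc 0 T, ∫ τ in (0 : ℝ)..t, divergence (Ψ τ).toL2 = 0 := by
      intro t ht
      have := divergence_eq_integral hn hs hΨc ht (by simpa only [hΨ2] using heq t ht)
      rwa [hdiv t ht, hu₀, zero_add, eq_comm] at this
    have hzero : ∀ t ∈ Ico 0 T, divergence (Ψ t).toL2 = 0 := by
      intro t ht
      have a := hasDerivWithinAt_integral_of_continuousOn (continuousOn_divergence hn hs hΨc) ht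
      have b : HasDerivWithinAt (fun x => ∫ τ in (0 : ℝ)..x, divergence (Ψ τ).toL2) 0 (Ici t) t := by
        refine (hasDerivWithinAt_const t (Ici t) (0 : L2R n)).congr_of_eventuallyEq ?_
          (hint t ⟨ht.1, ht.2.le⟩)
        filter_upwards [Icc_mem_nhdsGE ht.2] with x hx
        exact hint x ⟨ht.1.trans hx.1, hx.2⟩
      exact (uniqueDiffOn_Ici t t self_mem_Ici).eq_deriv _ a b
    intro t ht
    rw [heq t ht]
    congr 1
    refine intervalIntegral.integral_congr_ae ?_
    have hne : ∀ᵐ τ : ℝ, τ ≠ T := compl_mem_ae_iff.mpr (measure_singleton T)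
    filter_upwards [hne] with τ hτ hτt
    rw [uIoc_of_le ht.1] at hτt
    have hτ' : τ ∈ Ico 0 T := ⟨hτt.1.le, lt_of_le_of_ne (hτt.2.trans ht.2) hτ⟩
    have hI : τ ∈ Icc 0 T := ⟨hτ'.1, hτ'.2.le⟩
    have hz := hzero τ hτ'
    rw [hΨ2] at hz
    rw [pressure_gradient_eq hn hs (hGw τ hI) (hdiv τ hI) hz]
    abel
  · intro h₀ hu
    obtain ⟨hc, heq⟩ := hu
    refine ⟨hc, fun t => -gradBS hs (u t),
      ((continuous_gradBS hs).comp_continuousOn hc).neg,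
      fun t _ => hasWeakGrad_neg_B hs (u t), fun t ht => ?_,
      divergence_eq_zero_of_modified hn hs h₀ ⟨hc, heq⟩⟩
    rw [heq t ht]
    congr 1
    refine intervalIntegral.integral_congr fun τ _ => ?_
    simp only [VSob.toL2_neg, toL2_gradBS]
    abel
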